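/- Let $(X,\Sigma,\mu)$ be a standard Borel probability space without atoms (a Lebesgue space with continuous normalized measure), and let $\mathcal A$ be the group of invertible measure preserving transformations of $(X,\Sigma,\mu)$, transformations that coincide mod $0$ being identified. Let $\mathcal G$ be a countable (discrete) group. A $\mathcal G$-action is a homomorphism $T:\mathcal G\to\mathcal A$, $g\mapsto T^g$; it is mixing if $\mu(T^gA\cap B)\to\mu(A)\mu(B)$ as $g\to\infty$ for all $A,B\in\Sigma$. Let $\mathcal M_{\mathcal G}$ be the set of mixing $\mathcal G$-actions. Let $A_1,A_2,\dots$ be measurable sets whose indicators span a dense linear subspace of $L^1(\mu)$ (for example, a sequence that is dense in the measure algebra, or one that generates $\Sigma$ and is closed under finite intersections), and let $|g|>0$ $(g\in\mathcal G)$ be numbers with $\sum_{g}2^{-|g|}<\infty$. Put $$d(T,S)=\sum_{i}\frac1{2^i}\bigl(\mu(TA_i\bigtriangleup SA_i)+\mu(T^{-1}A_i\bigtriangleup S^{-1}A_i)\bigr),\qquad a(T,S)=\sum_{i,j}\frac1{2^{i+j}}\bigl|\mu(TA_i\cap A_j)-\mu(SA_i\cap A_j)\bigr|$$ for $T,S\in\mathcal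 A$, and equip $\mathcal M_{\mathcal G}$ with the metric $$m(T,S)=\sum_{g\in\mathcal G}\frac1{2^{|g|}}\,d(T^g,S^g)+\sup_{g\in\mathcal G}a(T^g,S^g).$$ For $T\in\mathcal M_{\mathcal G}$ let $\overline T$ be the closure in $\mathcal M_{\mathcal G}$ of its conjugacy class $\{U^{-1}TU\}_{U\in\mathcal A}$. Then the set $W=\{T\in\mathcal M_{\mathcal G}\mid\overline T=\mathcal M_{\mathcal G}\}$ is generic, that is, $W$ is a $G_\delta$ set and is dense in $\mathcal M_{\mathcal G}$. -/

import Mathlib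

open MeasureTheory Filter Topology
open scoped symmDiff

noncomputable section

set_option linter.unusedSectionVars false

namespace MixingActions

section Transformations

variable {X : Type*} [MeasurableSpace X]

/-- The group of invertible measure preserving transformations of `(X, μ)`: bijections that are
measurable and measure preserving together with their inverses. -/
def MPAut (μ : Measure X) : Subgroup (Equiv.Perm X) where
  carrier := {σ | MeasurePreserving σ μ μ ∧ MeasurePreserving σ.symm μ μ}
  mul_mem' := fun ha hb => ⟨ha.1.comp hb.1, hb.2.comp ha.2⟩
  one_mem' := ⟨MeasurePreserving.id μ, MeasurePreserving.id μ⟩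
  inv_mem' := fun ha => ⟨ha.2, ha.1⟩

/-- The transformations that coincide with the identity mod 0. -/
def nullAut (μ : Measure X) : Subgroup (MPAut μ) where
  carrier := {σ | ∀ᵐ x ∂μ, σ.1 x = x}
  mul_mem' := by
    intro a b ha hb
    filter_upwards [hb, b.2.1.quasiMeasurePreserving.ae ha] with x h1 h2
    exact h2.trans h1
  one_mem' := by
    change ∀ᵐ x ∂μ, x = x
    exact Eventually.of_forall fun _ => rfl
  inv_mem' := by
    intro a ha
    filter_upwards [a.2.2.quasiMeasurePreserving.ae ha] with x h
    have h' : a.1 (a.1.symm x) = a.1.symm x := h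
    rw [Equiv.apply_symm_apply] at h'
    exact h'.symm

instance nullAut_normal (μ : Measure X) : (nullAut μ).Normal where
  conj_mem := by
    intro n hn g
    change ∀ᵐ x ∂μ, g.1 (n.1 (g.1.symm x)) = x
    filter_upwards [g.2.2.quasiMeasurePreserving.ae hn] with x h
    have h' : n.1 (g.1.symm x) = g.1.symm x := h
    rw [h', Equiv.apply_symm_apply]

/-- The group `𝒜` of invertible measure preserving transformations, where transformations that
coincide mod 0 are identified. -/
abbrev Transf (μ : Measure X) : Type _ := MPAut μ ⧸ nullAut μ

/-- Images of a measurable set under transformations that coincide mod 0 coincide mod 0. -/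
theorem image_ae_eq {μ : Measure X} {a b : MPAut μ} (h : a⁻¹ * b ∈ nullAut μ) (A : Set X) :
    (a.1 '' A : Set X) =ᵐ[μ] (b.1 '' A : Set X) := by
  have h1 : b⁻¹ * a ∈ nullAut μ := by simpa using (nullAut μ).inv_mem h
  have h2 := a.2.2.quasiMeasurePreserving.ae h1
  filter_upwards [h2] with x hx
  have hx' : b.1.symm (a.1 (a.1.symm x)) = a.1.symm x := hx
  rw [Equiv.apply_symm_apply] at hx'
  rw [Equiv.image_eq_preimage_symm, Equiv.image_eq_preimage_symm]
  change (a.1.symm x ∈ A) = (b.1.symm x ∈ A)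
  rw [hx']

/-- `overlap T A B = μ (T A ∩ B)`. -/
def overlap {μ : Measure X} (T : Transf μ) (A B : Set X) : ℝ :=
  Quotient.liftOn' T (fun σ => μ.real (σ.1 '' A ∩ B)) fun _ _ h =>
    measureReal_congr ((image_ae_eq (QuotientGroup.leftRel_apply.mp h) A).inter (ae_eq_refl B))

/-- `discrepancy T S A = μ (T A ∆ S A)`. -/
def discrepancy {μ : Measure X} (T S : Transf μ) (A : Set X) : ℝ :=
  Quotient.liftOn₂' T S (fun σ τ => μ.real ((σ.1 '' A) ∆ (τ.1 '' A))) fun _ _ _ _ h k =>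
    measureReal_congr ((image_ae_eq (QuotientGroup.leftRel_apply.mp h) A).symmDiff
      (image_ae_eq (QuotientGroup.leftRel_apply.mp k) A))

/-- `d(T, S) = ∑_{i ≥ 1} 2⁻ⁱ (μ (T Aᵢ ∆ S Aᵢ) + μ (T⁻¹ Aᵢ ∆ S⁻¹ Aᵢ))`; the sets `A₁, A₂, …` are
`A 0, A 1, …` here. -/
def weakDist {μ : Measure X} (A : ℕ → Set X) (T S : Transf μ) : ℝ :=
  ∑' i : ℕ, 1 / 2 ^ (i + 1) * (discrepancy T S (A i) + discrepancy T⁻¹ S⁻¹ (A i))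

/-- `a(T, S) = ∑_{i, j ≥ 1} 2^{-(i+j)} |μ (T Aᵢ ∩ Aⱼ) - μ (S Aᵢ ∩ Aⱼ)|`; the sets `A₁, A₂, …` are
`A 0, A 1, …` here. -/
def overlapDist {μ : Measure X} (A : ℕ → Set X) (T S : Transf μ) : ℝ :=
  ∑' p : ℕ × ℕ, 1 / 2 ^ ((p.1 + 1) + (p.2 + 1)) *
    |overlap T (A p.1) (A p.2) - overlap S (A p.1) (A p.2)|

/-- The measurable sets `A 0, A 1, …` generate the σ-algebra mod 0 linearly: the linear span of
their indicators is dense in `L¹(μ)` (every indicator of a measurable set can be approximated).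
This holds if they are dense in the measure algebra, and also if they generate the σ-algebra and
are closed under finite intersections. -/
def IsGeneratingFamily (μ : Measure X) (A : ℕ → Set X) : Prop :=
  (∀ i, MeasurableSet (A i)) ∧
    ∀ B : Set X, MeasurableSet B → ∀ ε : ℝ, 0 < ε → ∃ c : ℕ →₀ ℝ,
      ∫ x, |B.indicator 1 x - c.sum fun i r => r * (A i).indicator 1 x| ∂μ < ε

end Transformations

section Actions

variable {X : Type*} [MeasurableSpace X]

/-- A `G`-action `T` is mixing if `μ (T^g A ∩ B) → μ A * μ B` as `g → ∞` in the discrete group `G`,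
for all measurable `A`, `B`. -/
def IsMixing {μ : Measure X} {G : Type*} [Group G] (T : G →* Transf μ) : Prop :=
  ∀ A B : Set X, MeasurableSet A → MeasurableSet B →
    Tendsto (fun g => overlap (T g) A B) cofinite (𝓝 (μ.real A * μ.real B))

/-- The set of mixing actions of the (discrete) group `G` on `(X, μ)`, mod 0. -/
def MixingAction (G : Type*) [Group G] (μ : Measure X) : Type _ :=
  {T : G →* Transf μ // IsMixing T}

/-- `d(T, S) = ∑_g 2^{-|g|} d(T^g, S^g)`, with `ℓ g = |g|`. -/
def actionDist {μ : Measure X} {G : Type*} [Group G] (A : ℕ → Set X) (ℓ : G → ℝ)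
    (T S : G →* Transf μ) : ℝ :=
  ∑' g : G, 1 / (2 : ℝ) ^ ℓ g * weakDist A (T g) (S g)

/-- The lead metric `m(T, S) = d(T, S) + sup_g a(T^g, S^g)`. -/
def leadDist {μ : Measure X} {G : Type*} [Group G] (A : ℕ → Set X) (ℓ : G → ℝ)
    (T S : G →* Transf μ) : ℝ :=
  actionDist A ℓ T S + ⨆ g : G, overlapDist A (T g) (S g)

/-- The conjugacy class `{U⁻¹ T U}`, `U ∈ 𝒜`, of a mixing action. -/
def conjClass {μ : Measure X} {G : Type*} [Group G] (T : MixingAction G μ) :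
    Set (MixingAction G μ) :=
  {S | ∃ U : Transf μ, ∀ g : G, S.1 g = U⁻¹ * T.1 g * U}

/-- The set `W` of mixing actions whose conjugacy class has closure the whole space. -/
def denseConjSet (G : Type*) [Group G] {X : Type*} [MeasurableSpace X] (μ : Measure X)
    [TopologicalSpace (MixingAction G μ)] : Set (MixingAction G μ) :=
  {T | closure (conjClass T) = Set.univ}

end Actions

section MetricFacts

variable {X : Type*} [MeasurableSpace X] {μ : Measure X}

theorem discrepancy_nonneg (T S : Transf μ) (A : Set X) : 0 ≤ discrepancy T S A := by
  induction T using Quotient.inductionOn'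
  induction S using Quotient.inductionOn'
  exact measureReal_nonneg

theorem discrepancy_self (T : Transf μ) (A : Set X) : discrepancy T T A = 0 := by
  induction T using Quotient.inductionOn' with | _ σ
  change μ.real ((σ.1 '' A) ∆ (σ.1 '' A)) = 0
  simp

theorem discrepancy_comm (T S : Transf μ) (A : Set X) :
    discrepancy T S A = discrepancy S T A := by
  induction T using Quotient.inductionOn' with | _ σ
  induction S using Quotient.inductionOn' with | _ τ
  change μ.real ((σ.1 '' A) ∆ (τ.1 '' A)) = μ.real ((τ.1 '' A) ∆ (σ.1 '' A))
  rw [symmDiff_comm]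

variable [IsProbabilityMeasure μ]

theorem discrepancy_le_one (T S : Transf μ) (A : Set X) : discrepancy T S A ≤ 1 := by
  induction T using Quotient.inductionOn'
  induction S using Quotient.inductionOn'
  exact measureReal_le_one

theorem discrepancy_triangle (T S R : Transf μ) (A : Set X) :
    discrepancy T R A ≤ discrepancy T S A + discrepancy S R A := by
  induction T using Quotient.inductionOn' with | _ σ
  induction S using Quotient.inductionOn' with | _ τ
  induction R using Quotient.inductionOn' with | _ ρ
  exact measureReal_symmDiff_le _

theorem overlap_nonneg (T : Transf μ) (A B : Set X) : 0 ≤ overlap T A B := by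
  induction T using Quotient.inductionOn'
  exact measureReal_nonneg

theorem overlap_le_one (T : Transf μ) (A B : Set X) : overlap T A B ≤ 1 := by
  induction T using Quotient.inductionOn'
  exact measureReal_le_one

theorem summable_weight : Summable fun i : ℕ => (1 : ℝ) / 2 ^ (i + 1) := by
  have h := (summable_geometric_two).mul_left (1 / 2 : ℝ)
  refine h.congr fun i => ?_
  rw [pow_succ, one_div_pow]
  field_simp

theorem weakDist_summable (A : ℕ → Set X) (T S : Transf μ) :
    Summable fun i : ℕ =>
      (1 : ℝ) / 2 ^ (i + 1) * (discrepancy T S (A i) + discrepancy T⁻¹ S⁻¹ (A i)) := by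
  refine Summable.of_nonneg_of_le (fun i => ?_) (fun i => ?_) (summable_weight.mul_right 2)
  · have h1 := discrepancy_nonneg T S (A i)
    have h2 := discrepancy_nonneg T⁻¹ S⁻¹ (A i)
    positivity
  · have h1 := discrepancy_le_one T S (A i)
    have h2 := discrepancy_le_one T⁻¹ S⁻¹ (A i)
    gcongr
    linarith

theorem weakDist_nonneg (A : ℕ → Set X) (T S : Transf μ) : 0 ≤ weakDist A T S := by
  refine tsum_nonneg fun i => ?_
  have h1 := discrepancy_nonneg T S (A i)
  have h2 := discrepancy_nonneg T⁻¹ S⁻¹ (A i)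
  positivity

theorem weakDist_le (A : ℕ → Set X) (T S : Transf μ) :
    weakDist A T S ≤ ∑' i : ℕ, (1 : ℝ) / 2 ^ (i + 1) * 2 := by
  refine Summable.tsum_le_tsum (fun i => ?_) (weakDist_summable A T S)
    (summable_weight.mul_right 2)
  have h1 := discrepancy_le_one T S (A i)
  have h2 := discrepancy_le_one T⁻¹ S⁻¹ (A i)
  gcongr
  linarith

theorem weakDist_self (A : ℕ → Set X) (T : Transf μ) : weakDist A T T = 0 := by
  simp [weakDist, discrepancy_self]

theorem weakDist_comm (A : ℕ → Set X) (T S : Transf μ) : weakDist A T S = weakDist A S T := by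
  simp only [weakDist, discrepancy_comm T S, discrepancy_comm T⁻¹ S⁻¹]

theorem weakDist_triangle (A : ℕ → Set X) (T S R : Transf μ) :
    weakDist A T R ≤ weakDist A T S + weakDist A S R := by
  rw [weakDist, weakDist, weakDist,
    ← (weakDist_summable A T S).tsum_add (weakDist_summable A S R)]
  refine Summable.tsum_le_tsum (fun i => ?_) (weakDist_summable A T R)
    ((weakDist_summable A T S).add (weakDist_summable A S R))
  have h1 := discrepancy_triangle T S R (A i)
  have h2 := discrepancy_triangle T⁻¹ S⁻¹ R⁻¹ (A i)
  rw [← mul_add]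
  refine mul_le_mul_of_nonneg_left ?_ (by positivity)
  linarith

theorem summable_weight_prod :
    Summable fun p : ℕ × ℕ => (1 : ℝ) / 2 ^ ((p.1 + 1) + (p.2 + 1)) := by
  have h := summable_weight.mul_of_nonneg summable_weight
    (fun i => by positivity) (fun i => by positivity)
  refine h.congr fun p => ?_
  rw [pow_add _ (p.1 + 1) (p.2 + 1)]
  field_simp

theorem abs_overlap_sub_le (T S : Transf μ) (A B : Set X) :
    |overlap T A B - overlap S A B| ≤ 1 := by
  rw [abs_le]
  constructor <;>
    linarith [overlap_nonneg T A B, overlap_nonneg S A B, overlap_le_one T A B,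
      overlap_le_one S A B]

theorem overlapDist_summable (A : ℕ → Set X) (T S : Transf μ) :
    Summable fun p : ℕ × ℕ => (1 : ℝ) / 2 ^ ((p.1 + 1) + (p.2 + 1)) *
      |overlap T (A p.1) (A p.2) - overlap S (A p.1) (A p.2)| := by
  refine Summable.of_nonneg_of_le (fun p => by positivity) (fun p => ?_) summable_weight_prod
  exact mul_le_of_le_one_right (by positivity) (abs_overlap_sub_le _ _ _ _)

theorem overlapDist_nonneg (A : ℕ → Set X) (T S : Transf μ) : 0 ≤ overlapDist A T S :=
  tsum_nonneg fun p => by positivity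

theorem overlapDist_le (A : ℕ → Set X) (T S : Transf μ) :
    overlapDist A T S ≤ ∑' p : ℕ × ℕ, (1 : ℝ) / 2 ^ ((p.1 + 1) + (p.2 + 1)) :=
  Summable.tsum_le_tsum
    (fun p => mul_le_of_le_one_right (by positivity) (abs_overlap_sub_le _ _ _ _))
    (overlapDist_summable A T S) summable_weight_prod

theorem overlapDist_self (A : ℕ → Set X) (T : Transf μ) : overlapDist A T T = 0 := by
  simp [overlapDist]

theorem overlapDist_comm (A : ℕ → Set X) (T S : Transf μ) :
    overlapDist A T S = overlapDist A S T := by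
  simp only [overlapDist]
  exact tsum_congr fun p => by rw [abs_sub_comm]

theorem overlapDist_triangle (A : ℕ → Set X) (T S R : Transf μ) :
    overlapDist A T R ≤ overlapDist A T S + overlapDist A S R := by
  rw [overlapDist, overlapDist, overlapDist,
    ← (overlapDist_summable A T S).tsum_add (overlapDist_summable A S R)]
  refine Summable.tsum_le_tsum (fun p => ?_) (overlapDist_summable A T R)
    ((overlapDist_summable A T S).add (overlapDist_summable A S R))
  rw [← mul_add]
  gcongr
  exact abs_sub_le _ _ _

variable {G : Type*} [Group G]

theorem overlapDist_bddAbove (A : ℕ → Set X) (T S : G →* Transf μ) :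
    BddAbove (Set.range fun g : G => overlapDist A (T g) (S g)) :=
  ⟨_, by rintro _ ⟨g, rfl⟩; exact overlapDist_le A (T g) (S g)⟩

theorem actionDist_summable (A : ℕ → Set X) {ℓ : G → ℝ}
    (hℓ : Summable fun g => 1 / (2 : ℝ) ^ ℓ g) (T S : G →* Transf μ) :
    Summable fun g => 1 / (2 : ℝ) ^ ℓ g * weakDist A (T g) (S g) := by
  refine Summable.of_nonneg_of_le (fun g => ?_) (fun g => ?_)
    (hℓ.mul_right (∑' i : ℕ, (1 : ℝ) / 2 ^ (i + 1) * 2))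
  · exact mul_nonneg (by positivity) (weakDist_nonneg _ _ _)
  · exact mul_le_mul_of_nonneg_left (weakDist_le A (T g) (S g)) (by positivity)

theorem actionDist_nonneg (A : ℕ → Set X) (ℓ : G → ℝ) (T S : G →* Transf μ) :
    0 ≤ actionDist A ℓ T S :=
  tsum_nonneg fun _ => mul_nonneg (by positivity) (weakDist_nonneg _ _ _)

theorem leadDist_self (A : ℕ → Set X) (ℓ : G → ℝ) (T : G →* Transf μ) :
    leadDist A ℓ T T = 0 := by
  simp [leadDist, actionDist, weakDist_self, overlapDist_self]

theorem leadDist_comm (A : ℕ → Set X) (ℓ : G → ℝ) (T S : G →* Transf μ) :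
    leadDist A ℓ T S = leadDist A ℓ S T := by
  simp only [leadDist, actionDist]
  congr 1
  · exact tsum_congr fun g => by rw [weakDist_comm]
  · exact iSup_congr fun g => overlapDist_comm _ _ _

theorem leadDist_triangle (A : ℕ → Set X) {ℓ : G → ℝ}
    (hℓ : Summable fun g => 1 / (2 : ℝ) ^ ℓ g) (T S R : G →* Transf μ) :
    leadDist A ℓ T R ≤ leadDist A ℓ T S + leadDist A ℓ S R := by
  have h1 : actionDist A ℓ T R ≤ actionDist A ℓ T S + actionDist A ℓ S R := by
    rw [actionDist, actionDist, actionDist,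
      ← (actionDist_summable A hℓ T S).tsum_add (actionDist_summable A hℓ S R)]
    refine Summable.tsum_le_tsum (fun g => ?_) (actionDist_summable A hℓ T R)
      ((actionDist_summable A hℓ T S).add (actionDist_summable A hℓ S R))
    rw [← mul_add]
    exact mul_le_mul_of_nonneg_left (weakDist_triangle A (T g) (S g) (R g)) (by positivity)
  have h2 : (⨆ g : G, overlapDist A (T g) (R g)) ≤
      (⨆ g : G, overlapDist A (T g) (S g)) + ⨆ g : G, overlapDist A (S g) (R g) :=
    ciSup_le fun g => (overlapDist_triangle A (T g) (S g) (R g)).trans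
      (add_le_add (le_ciSup (overlapDist_bddAbove A T S) g)
        (le_ciSup (overlapDist_bddAbove A S R) g))
  unfold leadDist
  linarith

/-- A measure preserving bijection that fixes the sets of a generating family mod 0 is the
identity mod 0. -/
theorem mem_nullAut_of_family [StandardBorelSpace X] {A : ℕ → Set X}
    (hA : IsGeneratingFamily μ A) (n : MPAut μ)
    (hn : ∀ i, (n.1 ⁻¹' A i : Set X) =ᵐ[μ] A i) : n ∈ nullAut μ := by
  have key : ∀ B : Set X, MeasurableSet B → (n.1 ⁻¹' B : Set X) =ᵐ[μ] B := by
    intro B hB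
    set b : X → ℝ := B.indicator 1 with hb
    have hbi : Integrable b μ := (integrable_const (1 : ℝ)).indicator hB
    have hbn : Integrable (fun x => b (n.1 x)) μ := n.2.1.integrable_comp_of_integrable hbi
    have hint : Integrable (fun x => |b (n.1 x) - b x|) μ := (hbn.sub hbi).abs
    have hzero : ∫ x, |b (n.1 x) - b x| ∂μ = 0 := by
      refine le_antisymm (le_of_forall_pos_le_add fun ε hε => ?_)
        (integral_nonneg fun x => abs_nonneg _)
      obtain ⟨c, hc⟩ := hA.2 B hB (ε / 2) (half_pos hε)
      set f : X → ℝ := fun x => c.sum fun i r => r * (A i).indicator 1 x with hf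
      have hfi : Integrable f μ := by
        refine integrable_finsetSum _ fun i _ => ?_
        exact ((integrable_const (1 : ℝ)).indicator (hA.1 i)).const_mul _
      have hfn : (fun x => f (n.1 x)) =ᵐ[μ] f := by
        have hall : ∀ᵐ x ∂μ, ∀ i, (n.1 ⁻¹' A i) x = (A i) x := ae_all_iff.2 hn
        filter_upwards [hall] with x hx
        simp only [hf, Finsupp.sum]
        refine Finset.sum_congr rfl fun i _ => ?_
        have hxi : n.1 x ∈ A i ↔ x ∈ A i := iff_of_eq (hx i)
        by_cases h : x ∈ A i
        · simp [h, hxi.2 h]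
        · simp [h, mt hxi.1 h]
      have hg : Integrable (fun x => |b x - f x|) μ := (hbi.sub hfi).abs
      have hgn : ∫ x, |b (n.1 x) - f (n.1 x)| ∂μ = ∫ x, |b x - f x| ∂μ := by
        have hmap : AEStronglyMeasurable (fun x => |b x - f x|) (Measure.map n.1 μ) := by
          rw [n.2.1.map_eq]
          exact hg.aestronglyMeasurable
        have h0 := integral_map n.2.1.aemeasurable hmap
        rw [n.2.1.map_eq] at h0
        exact h0.symm
      have hgni : Integrable (fun x => |b (n.1 x) - f (n.1 x)|) μ :=
        n.2.1.integrable_comp_of_integrable hg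
      calc ∫ x, |b (n.1 x) - b x| ∂μ
          ≤ ∫ x, (|b (n.1 x) - f (n.1 x)| + |b x - f x|) ∂μ := by
            refine integral_mono_ae hint (hgni.add hg) ?_
            filter_upwards [hfn] with x hx
            have hx' : f (n.1 x) = f x := hx
            change |b (n.1 x) - b x| ≤ |b (n.1 x) - f (n.1 x)| + |b x - f x|
            rw [hx', abs_sub_comm (b x)]
            exact abs_sub_le _ _ _
        _ = ∫ x, |b x - f x| ∂μ + ∫ x, |b x - f x| ∂μ := by
            rw [integral_add hgni hg, hgn]
        _ ≤ 0 + ε := by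
            have hc' : ∫ x, |b x - f x| ∂μ < ε / 2 := hc
            linarith
    have hae := (integral_eq_zero_iff_of_nonneg (fun x => abs_nonneg _) hint).1 hzero
    filter_upwards [hae] with x hx
    have hx' : b (n.1 x) = b x := by
      have h0 : |b (n.1 x) - b x| = 0 := hx
      exact sub_eq_zero.1 (abs_eq_zero.1 h0)
    change (n.1 x ∈ B) = (x ∈ B)
    by_cases h1 : n.1 x ∈ B <;> by_cases h2 : x ∈ B <;> simp_all
  exact Filter.EventuallyEq.of_forall_separating_preimage
    (l := ae μ) (f := n.1) (g := id) MeasurableSet fun B hB => key B hB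

theorem eq_of_discrepancy_eq_zero [StandardBorelSpace X] {A : ℕ → Set X}
    (hA : IsGeneratingFamily μ A) (T S : Transf μ) (h : ∀ i, discrepancy T S (A i) = 0) :
    T = S := by
  induction T using Quotient.inductionOn' with | _ a
  induction S using Quotient.inductionOn' with | _ b
  refine Quotient.sound' (QuotientGroup.leftRel_apply.2 ?_)
  have hn : b⁻¹ * a ∈ nullAut μ := by
    refine mem_nullAut_of_family hA _ fun i => ?_
    have h0 : μ.real ((a.1 '' A i) ∆ (b.1 '' A i)) = 0 := h i
    rw [measureReal_eq_zero_iff, measure_symmDiff_eq_zero_iff] at h0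
    have h1 := a.2.1.quasiMeasurePreserving.ae h0
    filter_upwards [h1] with x hx
    rw [Equiv.image_eq_preimage_symm, Equiv.image_eq_preimage_symm] at hx
    have hx' : (a.1.symm (a.1 x) ∈ A i) = (b.1.symm (a.1 x) ∈ A i) := hx
    rw [Equiv.symm_apply_apply] at hx'
    exact hx'.symm
  simpa using (nullAut μ).inv_mem hn

theorem eq_of_leadDist_eq_zero [StandardBorelSpace X] {A : ℕ → Set X}
    (hA : IsGeneratingFamily μ A) {ℓ : G → ℝ} (hℓ : Summable fun g => 1 / (2 : ℝ) ^ ℓ g)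
    (T S : G →* Transf μ) (h : leadDist A ℓ T S = 0) : T = S := by
  have h1 := actionDist_nonneg A ℓ T S
  have h2 : 0 ≤ ⨆ g : G, overlapDist A (T g) (S g) :=
    Real.iSup_nonneg fun g => overlapDist_nonneg A (T g) (S g)
  have h3 : actionDist A ℓ T S = 0 := by
    unfold leadDist at h
    linarith
  have h4 := ((actionDist_summable A hℓ T S).hasSum_iff.2 h3)
  rw [hasSum_zero_iff_of_nonneg
    (fun g => mul_nonneg (by positivity) (weakDist_nonneg _ _ _))] at h4
  ext g
  have h5 : 1 / (2 : ℝ) ^ ℓ g * weakDist A (T g) (S g) = 0 := congrFun h4 g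
  have h6 : weakDist A (T g) (S g) = 0 :=
    (mul_eq_zero.1 h5).resolve_left (by positivity)
  refine eq_of_discrepancy_eq_zero hA _ _ fun i => ?_
  have h7 := ((weakDist_summable A (T g) (S g)).hasSum_iff.2 h6)
  rw [hasSum_zero_iff_of_nonneg] at h7
  · have h8 := (mul_eq_zero.1 (congrFun h7 i)).resolve_left (by positivity)
    have h9 := discrepancy_nonneg (T g) (S g) (A i)
    have h10 := discrepancy_nonneg (T g)⁻¹ (S g)⁻¹ (A i)
    linarith
  · intro i
    have h9 := discrepancy_nonneg (T g) (S g) (A i)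
    have h10 := discrepancy_nonneg (T g)⁻¹ (S g)⁻¹ (A i)
    change 0 ≤ (1 : ℝ) / 2 ^ (i + 1) * _
    positivity

/-- The space `𝓜_G` of mixing actions with the lead metric. -/
abbrev leadMetricSpace (G : Type*) [Group G] {X : Type*} [MeasurableSpace X]
    [StandardBorelSpace X] (μ : Measure X) [IsProbabilityMeasure μ] (A : ℕ → Set X)
    (hA : IsGeneratingFamily μ A) (ℓ : G → ℝ) (hℓ : Summable fun g => 1 / (2 : ℝ) ^ ℓ g) :
    MetricSpace (MixingAction G μ) where
  dist T S := leadDist A ℓ T.1 S.1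
  dist_self T := leadDist_self A ℓ T.1
  dist_comm T S := leadDist_comm A ℓ T.1 S.1
  dist_triangle T S R := leadDist_triangle A hℓ T.1 S.1 R.1
  eq_of_dist_eq_zero h := Subtype.ext (eq_of_leadDist_eq_zero hA hℓ _ _ h)

end MetricFacts

end MixingActions

end

set_option linter.unusedSectionVars false

/-! The proof exhibits one mixing action whose conjugacy class is dense; every action in that class
then lies in W, so W is dense, and no Baire argument is needed.

The space is separable in the lead metric (`secondCountable_leadMetricSpace`). The supremum over the
group looks like an obstacle, but mixing makes each overlap function of g equal to its limit up to ε
off a finite set, so up to ε it is described by a finitely supported integer function. Take a dense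
sequence of mixing actions and form its infinite product. The product is mixing, its underlying
space is again a Lebesgue space, and every action of the sequence is a factor of it by a coordinate
projection (`exists_common_extension`).

A factor T of R lies in the closure of the conjugacy class of R
(`mem_closure_conjClass_of_isFactorMap`). On finitely many sets the preimage under the factor map π
agrees mod 0 with the image under an invertible u (`exists_MPAut_preimage_ae_eq`, from the
classification of Lebesgue spaces). If these sets are the first Aᵢ, the conjugate of R by u has
exactly the overlaps of T on them, for all g at once; this handles the supremum. The remaining part
of the metric is controlled by finitely many g.

For the Gδ part, W is the set of T such that each nonempty basic open set contains some conjugate of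
T. Conjugation by a fixed u is continuous (`continuous_conjAction`) and the basis is countable. -/

namespace MixingActions

/-! ### Uniform coordinates on atomless standard Borel spaces -/

section LebesgueCoordinate

open ProbabilityTheory Set

theorem continuous_cdf (ν : Measure ℝ) [IsProbabilityMeasure ν] [NullSingletonClass ν] :
    Continuous (cdf ν) := by
  refine continuous_iff_continuousAt.2 fun x => ?_
  rw [(monotone_cdf ν).continuousAt_iff_leftLim_eq_rightLim, StieltjesFunction.rightLim_eq]
  have h := (cdf ν).measure_singleton x
  rw [measure_cdf, measure_singleton, eq_comm, ENNReal.ofReal_eq_zero] at h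
  exact le_antisymm ((monotone_cdf ν).leftLim_le le_rfl) (by linarith)

theorem exists_cdf_eq (ν : Measure ℝ) [IsProbabilityMeasure ν] [NullSingletonClass ν] {a : ℝ}
    (ha : a ∈ Ioo (0 : ℝ) 1) : ∃ x, cdf ν x = a := by
  obtain ⟨u, hu⟩ := ((tendsto_cdf_atBot ν).eventually (gt_mem_nhds ha.1)).exists
  obtain ⟨v, hv⟩ := ((tendsto_cdf_atTop ν).eventually (lt_mem_nhds ha.2)).exists
  exact mem_range_of_exists_le_of_exists_ge (continuous_cdf ν) ⟨u, hu.le⟩ ⟨v, hv.le⟩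

/-- By the intermediate value theorem a level in (0, 1) is attained at some x, and the half-line up
to x has that mass. The distribution function may be constant to the right of x, so the upper bound
uses levels b > a. -/
theorem measure_cdf_le (ν : Measure ℝ) [IsProbabilityMeasure ν] [NullSingletonClass ν] {a : ℝ}
    (h0 : 0 ≤ a) (h1 : a < 1) : ν {x | cdf ν x ≤ a} = ENNReal.ofReal a := by
  refine le_antisymm ?_ ?_
  · refine le_of_forall_gt_imp_ge_of_dense fun c hc => ?_
    obtain ⟨b, hab, hbc⟩ : ∃ b : ℝ, b ∈ Ioo a 1 ∧ ENNReal.ofReal b ≤ c := by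
      have h := (ENNReal.continuous_ofReal.tendsto a).eventually (gt_mem_nhds hc)
      have h2 : ∀ᶠ b in 𝓝[>] a, b ∈ Ioo a 1 := Ioo_mem_nhdsGT h1
      obtain ⟨b, hb, hb'⟩ := ((h.filter_mono nhdsWithin_le_nhds).and h2).exists
      exact ⟨b, hb', hb.le⟩
    obtain ⟨x, hx⟩ := exists_cdf_eq ν ⟨h0.trans_lt hab.1, hab.2⟩
    refine le_trans ?_ hbc
    rw [← hx, ofReal_cdf]
    refine measure_mono fun y hy => ?_
    by_contra hxy
    have := monotone_cdf ν (le_of_lt (not_le.1 hxy))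
    have hy' : cdf ν y ≤ a := hy
    linarith [hab.1]
  · rcases h0.eq_or_lt with rfl | h0
    · simp
    · obtain ⟨x, hx⟩ := exists_cdf_eq ν ⟨h0, h1⟩
      rw [← hx, ofReal_cdf]
      exact measure_mono fun y hy => monotone_cdf ν hy

theorem map_cdf (ν : Measure ℝ) [IsProbabilityMeasure ν] [NullSingletonClass ν] :
    ν.map (cdf ν) = volume.restrict (Icc (0 : ℝ) 1) := by
  have hm : Measurable (cdf ν) := (monotone_cdf ν).measurable
  have : IsProbabilityMeasure (ν.map (cdf ν)) :=
    Measure.isProbabilityMeasure_map hm.aemeasurable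
  refine Measure.ext_of_Iic _ _ fun a => ?_
  rw [Measure.map_apply hm measurableSet_Iic, Measure.restrict_apply measurableSet_Iic]
  change ν {x | cdf ν x ≤ a} = _
  rcases lt_or_ge a 0 with h | h
  · have e1 : {x | cdf ν x ≤ a} = ∅ := by
      ext x
      simpa using h.trans_le (cdf_nonneg ν x)
    have e2 : Iic a ∩ Icc (0 : ℝ) 1 = ∅ := by
      ext x
      simp only [mem_inter_iff, mem_Iic, mem_Icc, mem_empty_iff_false, iff_false]
      intro hx
      linarith [hx.1, hx.2.1]
    rw [e1, e2]
    simp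
  rcases lt_or_ge a 1 with h' | h'
  · rw [measure_cdf_le ν h h']
    have e2 : Iic a ∩ Icc (0 : ℝ) 1 = Icc 0 a := by
      ext x
      simp only [mem_inter_iff, mem_Iic, mem_Icc]
      constructor
      · rintro ⟨h1, h2, -⟩; exact ⟨h2, h1⟩
      · rintro ⟨h1, h2⟩; exact ⟨h2, h1, h2.trans h'.le⟩
    rw [e2, Real.volume_Icc, sub_zero]
  · have e1 : {x | cdf ν x ≤ a} = univ := by
      ext x
      simpa using (cdf_le_one ν x).trans h'
    have e2 : Iic a ∩ Icc (0 : ℝ) 1 = Icc 0 1 :=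
      inter_eq_right.2 fun x hx => hx.2.trans h'
    rw [e1, e2]
    simp

/-- Two points with equal value bound an interval of constancy, which contains a rational. The
fibres through rationals are countably many, and each is null because the image measure is Lebesgue.
-/
theorem exists_injOn_cdf (ν : Measure ℝ) [IsProbabilityMeasure ν] [NullSingletonClass ν] :
    ∃ B : Set ℝ, MeasurableSet B ∧ ν B = 0 ∧ InjOn (cdf ν) Bᶜ := by
  have hm : Measurable (cdf ν) := (monotone_cdf ν).measurable
  refine ⟨⋃ q : ℚ, cdf ν ⁻¹' {cdf ν q}, MeasurableSet.iUnion fun q => hm (measurableSet_singleton _),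
    measure_iUnion_null fun q => ?_, ?_⟩
  · rw [← Measure.map_apply hm (measurableSet_singleton _), map_cdf]
    exact measure_singleton _
  · have key : ∀ x y, x < y → cdf ν x = cdf ν y → x ∈ ⋃ q : ℚ, cdf ν ⁻¹' {cdf ν q} := by
      intro x y hxy h
      obtain ⟨q, h1, h2⟩ := exists_rat_btwn hxy
      refine mem_iUnion.2 ⟨q, le_antisymm (monotone_cdf ν h1.le) ?_⟩
      rw [h]
      exact monotone_cdf ν h2.le
    intro x hx y hy h
    rcases lt_trichotomy x y with hxy | hxy | hxy
    · exact absurd (key x y hxy h) hx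
    · exact hxy
    · exact absurd (key y x hxy h.symm) hy

variable {X : Type*} [MeasurableSpace X] [StandardBorelSpace X]

/-- A standard Borel probability space without atoms has a coordinate with uniform distribution on
`[0, 1]` that is injective mod 0; the coordinate may be chosen increasing with respect to a given
function with values in `ℕ`. -/
theorem exists_lebesgue_coordinate (μ : Measure X) [IsProbabilityMeasure μ] [NullSingletonClass μ]
    {κ : X → ℕ} (hκ : Measurable κ) :
    ∃ f : X → ℝ, Measurable f ∧ μ.map f = volume.restrict (Icc (0 : ℝ) 1) ∧
      (∃ B : Set X, MeasurableSet B ∧ μ B = 0 ∧ InjOn f Bᶜ) ∧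
      ∀ x, μ.real {z | κ z < κ x} ≤ f x ∧ f x ≤ μ.real {z | κ z < κ x + 1} := by
  obtain ⟨e, he⟩ := exists_measurableEmbedding_real X
  -- The integer part of `j` is `κ` and its fractional part is an injective coordinate in (0, 1).
  -- Ordering by `j` therefore sorts by `κ` first, and the distribution function of `j` sends each
  -- level of `κ` between consecutive cumulative masses.
  set j : X → ℝ := fun x => κ x + Real.sigmoid (e x) with hj
  have hjm : Measurable j :=
    (measurable_from_nat.comp hκ).add
      (Real.sigmoid_monotone.measurable.comp he.measurable)
  have hκle : ∀ x y, j x ≤ j y → κ x ≤ κ y := by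
    intro x y h
    by_contra hlt
    have h1 : (κ y : ℝ) + 1 ≤ κ x := by exact_mod_cast not_le.1 hlt
    have h2 := Real.sigmoid_pos (e x)
    have h3 := Real.sigmoid_lt_one (e y)
    simp only [hj] at h
    linarith
  have hji : Function.Injective j := by
    intro x y h
    have h1 : κ x = κ y := le_antisymm (hκle x y h.le) (hκle y x h.ge)
    simp only [hj, h1, add_right_inj] at h
    exact he.injective (Real.sigmoid_injective h)
  have hp : IsProbabilityMeasure (μ.map j) := Measure.isProbabilityMeasure_map hjm.aemeasurable
  have hns : NullSingletonClass (μ.map j) := ⟨fun x => by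
    rw [Measure.map_apply hjm (measurableSet_singleton x)]
    exact (subsingleton_singleton.preimage hji).measure_zero μ⟩
  have hcm : Measurable (cdf (μ.map j)) := (monotone_cdf _).measurable
  have hval : ∀ x, cdf (μ.map j) (j x) = μ.real {z | j z ≤ j x} := fun x => by
    rw [cdf_eq_real, map_measureReal_apply hjm measurableSet_Iic]
    rfl
  refine ⟨fun x => cdf (μ.map j) (j x), hcm.comp hjm, ?_, ?_, fun x => ?_⟩
  · rw [← map_cdf (μ.map j), Measure.map_map hcm hjm]
    rfl
  · obtain ⟨B, hB, hB0, hBi⟩ := exists_injOn_cdf (μ.map j)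
    refine ⟨j ⁻¹' B, hjm hB, ?_, fun x hx y hy h => hji (hBi hx hy h)⟩
    rw [← Measure.map_apply hjm hB, hB0]
  · change _ ≤ cdf (μ.map j) (j x) ∧ cdf (μ.map j) (j x) ≤ _
    rw [hval]
    refine ⟨measureReal_mono fun z hz => ?_, measureReal_mono fun z hz => ?_⟩
    · by_contra h
      exact absurd (hκle x z (not_le.1 h).le) (not_le.2 hz)
    · exact Nat.lt_succ_of_le (hκle z x hz)

/-- The Liouville numbers are comeagre, and so is the complement of a countable set. Being also
Lebesgue null, they provide uncountable null sets. -/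
theorem not_countable_liouville_inter :
    ¬ ({x : ℝ | Liouville x} ∩ Ioo 0 1).Countable := by
  intro h
  have h1 : ({x : ℝ | Liouville x} ∩ Ioo 0 1)ᶜ ∈ residual ℝ :=
    residual_of_dense_Gδ h.isGδ_compl (h.dense_compl ℝ)
  obtain ⟨x, hx, hx1, hx2⟩ := ((dense_of_mem_residual
    (inter_mem eventually_residual_liouville h1)).inter_open_nonempty (Ioo (0 : ℝ) 1)
    isOpen_Ioo ⟨1 / 2, by norm_num, by norm_num⟩)
  exact hx2 ⟨hx1, hx⟩

/-- Such a set is the spare room needed to turn an isomorphism mod 0 into a genuine bijection. It is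
obtained by pulling the Liouville numbers back along a uniform coordinate. -/
theorem exists_null_not_countable (μ : Measure X) [IsProbabilityMeasure μ]
    [NullSingletonClass μ] : ∃ N : Set X, MeasurableSet N ∧ μ N = 0 ∧ ¬ N.Countable := by
  have hX : ¬ Countable X := fun h => by
    have h1 := (countable_univ (α := X)).measure_zero μ
    simp at h1
  have hR : ¬ Countable ℝ := not_countable
  let e : X ≃ᵐ ℝ := PolishSpace.measurableEquivOfNotCountable hX hR
  have hp : IsProbabilityMeasure (μ.map e) :=
    Measure.isProbabilityMeasure_map e.measurable.aemeasurable
  have hns : NullSingletonClass (μ.map e) := ⟨fun x => by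
    rw [Measure.map_apply e.measurable (measurableSet_singleton x)]
    exact (subsingleton_singleton.preimage e.injective).measure_zero μ⟩
  have hcm : Measurable (cdf (μ.map e)) := (monotone_cdf _).measurable
  have hL : MeasurableSet ({x : ℝ | Liouville x} ∩ Ioo 0 1) :=
    IsGδ.setOfPred_liouville.measurableSet.inter measurableSet_Ioo
  refine ⟨e ⁻¹' (cdf (μ.map e) ⁻¹' ({x : ℝ | Liouville x} ∩ Ioo 0 1)), e.measurable (hcm hL),
    ?_, fun h => ?_⟩
  · rw [← Measure.map_apply e.measurable (hcm hL), ← Measure.map_apply hcm hL, map_cdf]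
    refine Measure.restrict_apply_eq_zero hL |>.2 (measure_mono_null ?_ volume_setOfPred_liouville)
    exact inter_subset_left.trans inter_subset_left
  · refine not_countable_liouville_inter ((h.image fun x => cdf (μ.map e) (e x)).mono ?_)
    intro a ha
    obtain ⟨x, hx⟩ := exists_cdf_eq (μ.map e) ha.2
    refine ⟨e.symm x, ?_, ?_⟩
    · simp only [mem_preimage, MeasurableEquiv.apply_symm_apply, hx]
      exact ha
    · simp [hx]

end LebesgueCoordinate

/-! ### Isomorphism of Lebesgue spaces relative to a countable partition -/

section Isomorphism

open Set

variable {X Y : Type*} [MeasurableSpace X] [StandardBorelSpace X] [MeasurableSpace Y]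
  [StandardBorelSpace Y]

/-- A Borel isomorphism between two sets with uncountable complements extends to the whole
spaces. -/
theorem exists_measurableEquiv_extension {S : Set X} {R : Set Y} (hS : MeasurableSet S)
    (hR : MeasurableSet R) (hS' : ¬ Sᶜ.Countable) (hR' : ¬ Rᶜ.Countable) (e : S ≃ᵐ R) :
    ∃ φ : X ≃ᵐ Y, ∀ x : S, φ x = e x := by
  classical
  have : StandardBorelSpace (Sᶜ : Set X) := hS.compl.standardBorel
  have : StandardBorelSpace (Rᶜ : Set Y) := hR.compl.standardBorel
  let e' : (Sᶜ : Set X) ≃ᵐ (Rᶜ : Set Y) := PolishSpace.measurableEquivOfNotCountable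
    (fun h => hS' (countable_coe_iff.1 h)) (fun h => hR' (countable_coe_iff.1 h))
  refine ⟨(MeasurableEquiv.sumCompl hS).symm.trans
    ((MeasurableEquiv.sumCongr e e').trans (MeasurableEquiv.sumCompl hR)), fun x => ?_⟩
  have h : (MeasurableEquiv.sumCompl hS).symm (x : X) = Sum.inl x :=
    (MeasurableEquiv.sumCompl hS).symm_apply_eq.2 rfl
  simp only [MeasurableEquiv.trans_apply, h]
  rfl

theorem exists_measurableEquiv_of_eq {Z : Type*} [MeasurableSpace Z] {s t : Set Z} (h : s = t) :
    ∃ e : s ≃ᵐ t, ∀ x, (e x : Z) = x := by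
  subst h
  exact ⟨MeasurableEquiv.refl _, fun _ => rfl⟩

/-- Two standard Borel probability spaces without atoms, each with a function with values in `ℕ`,
are isomorphic by an isomorphism that respects the functions, provided that these have the same
distribution. -/
theorem exists_measurableEquiv_of_distribution (μ : Measure X) (ν : Measure Y)
    [IsProbabilityMeasure μ] [IsProbabilityMeasure ν] [NullSingletonClass μ]
    [NullSingletonClass ν] {κ : X → ℕ} {η : Y → ℕ} (hκ : Measurable κ) (hη : Measurable η)
    (h : μ.map κ = ν.map η) :
    ∃ φ : X ≃ᵐ Y, MeasurePreserving φ μ ν ∧ ∀ᵐ x ∂μ, η (φ x) = κ x := by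
  obtain ⟨f, hf, hfl, ⟨B, hB, hB0, hfi⟩, hfκ⟩ := exists_lebesgue_coordinate μ hκ
  obtain ⟨g, hg, hgl, ⟨C, hC, hC0, hgi⟩, hgη⟩ := exists_lebesgue_coordinate ν hη
  obtain ⟨N, hN, hN0, hNu⟩ := exists_null_not_countable μ
  obtain ⟨M, hM, hM0, hMu⟩ := exists_null_not_countable ν
  have hs : ∀ k, ν.real {z | η z < k} = μ.real {z | κ z < k} := by
    intro k
    have h1 : (μ.map κ) (Iio k) = (ν.map η) (Iio k) := by rw [h]
    rw [Measure.map_apply hκ measurableSet_Iio, Measure.map_apply hη measurableSet_Iio] at h1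
    exact (congrArg ENNReal.toReal h1).symm
  have hsm : ∀ k l, k ≤ l → μ.real {z | κ z < k} ≤ μ.real {z | κ z < l} := fun k l hkl =>
    measureReal_mono fun z hz => lt_of_lt_of_le hz hkl
  -- These are the endpoints separating the levels. Off this countable set, the value of the
  -- coordinate determines the level.
  set D : Set ℝ := range fun k : ℕ => μ.real {z | κ z < k} with hD
  have hDc : D.Countable := countable_range _
  have hDm : MeasurableSet D := hDc.measurableSet
  -- Discarding the uncountable null set keeps the complement uncountable, as the extension of the
  -- isomorphism requires.
  set S₀ : Set X := (B ∪ N)ᶜ with hS₀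
  set R₀ : Set Y := (C ∪ M)ᶜ with hR₀
  have hS₀m : MeasurableSet S₀ := (hB.union hN).compl
  have hR₀m : MeasurableSet R₀ := (hC.union hM).compl
  have hS₀i : InjOn f S₀ := hfi.mono (compl_subset_compl.2 subset_union_left)
  have hR₀i : InjOn g R₀ := hgi.mono (compl_subset_compl.2 subset_union_left)
  set E : Set ℝ := (f '' S₀ ∩ g '' R₀) \ D with hE
  have hEm : MeasurableSet E :=
    ((hS₀m.image_of_measurable_injOn hf hS₀i).inter
      (hR₀m.image_of_measurable_injOn hg hR₀i)).diff hDm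
  have hS₀0 : μ S₀ᶜ = 0 := by rw [hS₀, compl_compl]; exact measure_union_null hB0 hN0
  have hR₀0 : ν R₀ᶜ = 0 := by rw [hR₀, compl_compl]; exact measure_union_null hC0 hM0
  have hfS : volume.restrict (Icc (0 : ℝ) 1) (f '' S₀)ᶜ = 0 := by
    rw [← hfl, Measure.map_apply hf (hS₀m.image_of_measurable_injOn hf hS₀i).compl]
    exact measure_mono_null (fun x hx hx' => hx (mem_image_of_mem f hx')) hS₀0
  have hgR : volume.restrict (Icc (0 : ℝ) 1) (g '' R₀)ᶜ = 0 := by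
    rw [← hgl, Measure.map_apply hg (hR₀m.image_of_measurable_injOn hg hR₀i).compl]
    exact measure_mono_null (fun x hx hx' => hx (mem_image_of_mem g hx')) hR₀0
  have hE0 : volume.restrict (Icc (0 : ℝ) 1) Eᶜ = 0 := by
    refine measure_mono_null ?_ (measure_union_null (measure_union_null hfS hgR)
      (hDc.measure_zero (volume.restrict (Icc (0 : ℝ) 1))))
    intro x hx
    by_contra hx'
    simp only [mem_union, mem_compl_iff, not_or, not_not] at hx'
    exact hx ⟨hx'.1, hx'.2⟩
  set S : Set X := S₀ ∩ f ⁻¹' E with hS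
  set R : Set Y := R₀ ∩ g ⁻¹' E with hR
  have hSm : MeasurableSet S := hS₀m.inter (hf hEm)
  have hRm : MeasurableSet R := hR₀m.inter (hg hEm)
  have hS0 : μ Sᶜ = 0 := by
    rw [hS, compl_inter]
    refine measure_union_null hS₀0 ?_
    rw [← preimage_compl, ← Measure.map_apply hf hEm.compl, hfl, hE0]
  have hR0 : ν Rᶜ = 0 := by
    rw [hR, compl_inter]
    refine measure_union_null hR₀0 ?_
    rw [← preimage_compl, ← Measure.map_apply hg hEm.compl, hgl, hE0]
  have : StandardBorelSpace S := hSm.standardBorel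
  have : StandardBorelSpace R := hRm.standardBorel
  have hfe : MeasurableEmbedding fun x : S => f x :=
    (hf.comp measurable_subtype_coe).measurableEmbedding
      fun x y hxy => Subtype.ext (hS₀i x.2.1 y.2.1 hxy)
  have hge : MeasurableEmbedding fun x : R => g x :=
    (hg.comp measurable_subtype_coe).measurableEmbedding
      fun x y hxy => Subtype.ext (hR₀i x.2.1 y.2.1 hxy)
  have hrange : (range fun x : S => f x) = range fun x : R => g x := by
    have h1 : (range fun x : S => f x) = E := by
      ext t
      constructor
      · rintro ⟨x, rfl⟩; exact x.2.2
      · intro ht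
        obtain ⟨x, hx, rfl⟩ := ht.1.1
        exact ⟨⟨x, hx, ht⟩, rfl⟩
    have h2 : (range fun x : R => g x) = E := by
      ext t
      constructor
      · rintro ⟨x, rfl⟩; exact x.2.2
      · intro ht
        obtain ⟨x, hx, rfl⟩ := ht.1.2
        exact ⟨⟨x, hx, ht⟩, rfl⟩
    rw [h1, h2]
  obtain ⟨e, he⟩ : ∃ e : S ≃ᵐ R, ∀ x : S, g (e x) = f x := by
    obtain ⟨r, hr⟩ := exists_measurableEquiv_of_eq hrange
    refine ⟨hfe.equivRange.trans (r.trans hge.equivRange.symm), fun x => ?_⟩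
    have h1 := congrArg Subtype.val
      (hge.equivRange.apply_symm_apply (r (hfe.equivRange x)))
    rw [hge.equivRange_apply, hr, hfe.equivRange_apply] at h1
    rw [MeasurableEquiv.trans_apply, MeasurableEquiv.trans_apply, hfe.equivRange_apply]
    exact h1
  obtain ⟨φ, hφ⟩ := exists_measurableEquiv_extension hSm hRm
    (mt (Countable.mono fun x (hx : x ∈ N) (hx' : x ∈ S) => hx'.1 (Or.inr hx)) hNu)
    (mt (Countable.mono fun x (hx : x ∈ M) (hx' : x ∈ R) => hx'.1 (Or.inr hx)) hMu) e
  have hφR : ∀ x ∈ S, φ x ∈ R := fun x hx => by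
    rw [hφ ⟨x, hx⟩]
    exact (e ⟨x, hx⟩).2
  have hφg : ∀ x ∈ S, g (φ x) = f x := fun x hx => by
    rw [hφ ⟨x, hx⟩]
    exact he ⟨x, hx⟩
  have hSae : ∀ᵐ x ∂μ, x ∈ S := hS0
  have hRae : ∀ᵐ x ∂ν, x ∈ R := hR0
  refine ⟨φ, ⟨φ.measurable, ?_⟩, ?_⟩
  · refine Measure.ext fun Z hZ => ?_
    -- Both measures of `Z` are read off as the Lebesgue measure of this subset of the unit
    -- interval.
    have hZR : MeasurableSet (g '' (Z ∩ R)) :=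
      (hZ.inter hRm).image_of_measurable_injOn hg (hR₀i.mono fun x hx => hx.2.1)
    rw [Measure.map_apply φ.measurable hZ]
    calc μ (φ ⁻¹' Z) = μ (f ⁻¹' (g '' (Z ∩ R))) := by
          refine measure_congr ?_
          filter_upwards [hSae] with x hx
          refine propext ⟨fun hz => ⟨φ x, ⟨hz, hφR x hx⟩, hφg x hx⟩, ?_⟩
          rintro ⟨y, hy, hyx⟩
          have : y = φ x := hR₀i hy.2.1 (hφR x hx).1 (hyx.trans (hφg x hx).symm)
          rw [this] at hy
          exact hy.1
      _ = ν (g ⁻¹' (g '' (Z ∩ R))) := by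
          rw [← Measure.map_apply hf hZR, ← Measure.map_apply hg hZR, hfl, hgl]
      _ = ν Z := by
          refine measure_congr ?_
          filter_upwards [hRae] with y hy
          refine propext ⟨?_, fun hz => ⟨y, ⟨hz, hy⟩, rfl⟩⟩
          rintro ⟨z, hz, hzy⟩
          have : z = y := hR₀i hz.2.1 hy.1 hzy
          exact this ▸ hz.1
  · filter_upwards [hSae] with x hx
    -- The common coordinate lies between the cumulative masses for `κ x` and also between those for
    -- `η (φ x)`. Distinct levels would force it to be an endpoint in `D`.
    have h1 := hfκ x
    have h2 := hgη (φ x)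
    rw [hφg x hx, hs, hs] at h2
    have h3 : f x ∉ D := hx.2.2
    have hD' : ∀ k, f x ≠ μ.real {z | κ z < k} := fun k hk => h3 ⟨k, hk.symm⟩
    rcases lt_trichotomy (η (φ x)) (κ x) with hlt | heq | hlt
    · exact absurd (le_antisymm (h2.2.trans (hsm _ _ hlt)) h1.1) (hD' _)
    · exact heq
    · exact absurd (le_antisymm (h1.2.trans (hsm _ _ hlt)) h2.1) (hD' _)

end Isomorphism

/-! ### Approximation by a generating family, uniformly in the transformation -/

section Approximation

variable {X : Type*} [MeasurableSpace X] {μ : Measure X}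

theorem MPAut.measurable_symm (σ : MPAut μ) : Measurable σ.1.symm := σ.2.2.measurable

theorem MPAut.measurableSet_image (σ : MPAut μ) {B : Set X} (hB : MeasurableSet B) :
    MeasurableSet (σ.1 '' B) := by
  rw [Equiv.image_eq_preimage_symm]
  exact MPAut.measurable_symm σ hB

theorem MPAut.measureReal_image (σ : MPAut μ) {B : Set X} (hB : MeasurableSet B) :
    μ.real (σ.1 '' B) = μ.real B := by
  rw [Equiv.image_eq_preimage_symm]
  exact σ.2.2.measureReal_preimage hB.nullMeasurableSet

theorem MPAut.indicator_image (σ : MPAut μ) (B : Set X) (x : X) :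
    (σ.1 '' B).indicator (1 : X → ℝ) x = B.indicator 1 (σ.1.symm x) := by
  rw [Equiv.image_eq_preimage_symm]
  rfl

theorem MPAut.integral_comp_symm (σ : MPAut μ) {f : X → ℝ} (hf : Integrable f μ) :
    ∫ x, f (σ.1.symm x) ∂μ = ∫ x, f x ∂μ := by
  have h0 := integral_map (μ := μ) (φ := σ.1.symm) (f := f) σ.2.2.aemeasurable
    (by rw [σ.2.2.map_eq]; exact hf.aestronglyMeasurable)
  rw [σ.2.2.map_eq] at h0
  exact h0.symm

variable [IsProbabilityMeasure μ]

theorem measureReal_inter_eq_integral {B C : Set X} (hB : MeasurableSet B)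
    (hC : MeasurableSet C) :
    μ.real (B ∩ C) = ∫ x, B.indicator (1 : X → ℝ) x * C.indicator 1 x ∂μ := by
  rw [← integral_indicator_one (hB.inter hC), Set.inter_indicator_one]
  rfl

theorem measureReal_symmDiff_eq_integral {B C : Set X} (hB : MeasurableSet B)
    (hC : MeasurableSet C) :
    μ.real (B ∆ C) = ∫ x, |B.indicator (1 : X → ℝ) x - C.indicator 1 x| ∂μ := by
  rw [← integral_indicator_one (hB.symmDiff hC)]
  refine integral_congr_ae (Eventually.of_forall fun x => ?_)
  by_cases h1 : x ∈ B <;> by_cases h2 : x ∈ C <;> simp [h1, h2, Set.mem_symmDiff]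

theorem integrable_indicator_one {B : Set X} (hB : MeasurableSet B) :
    Integrable (B.indicator (1 : X → ℝ)) μ :=
  (integrable_const (1 : ℝ)).indicator hB

theorem integrable_sum_indicator {A : ℕ → Set X} (hA : ∀ i, MeasurableSet (A i)) (c : ℕ →₀ ℝ) :
    Integrable (fun x => c.sum fun i r => r * (A i).indicator (1 : X → ℝ) x) μ :=
  integrable_finsetSum _ fun i _ => (integrable_indicator_one (hA i)).const_mul _

/-- Overlaps with `T B` are approximated by linear combinations of overlaps with the sets `T Aᵢ`,
uniformly in `T`. -/
theorem exists_overlap_approx {A : ℕ → Set X} (hA : IsGeneratingFamily μ A) {B : Set X}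
    (hB : MeasurableSet B) {ε : ℝ} (hε : 0 < ε) :
    ∃ c : ℕ →₀ ℝ, ∀ (T : Transf μ) (C : Set X), MeasurableSet C →
      |overlap T B C - c.sum fun i r => r * overlap T (A i) C| ≤ ε := by
  obtain ⟨c, hc⟩ := hA.2 B hB ε hε
  refine ⟨c, fun T C hC => ?_⟩
  induction T using Quotient.inductionOn' with | _ σ
  change |μ.real (σ.1 '' B ∩ C) - c.sum fun i r => r * μ.real (σ.1 '' A i ∩ C)| ≤ ε
  have hbi : ∀ D : Set X, MeasurableSet D →
      Integrable (fun x => D.indicator (1 : X → ℝ) (σ.1.symm x) * C.indicator 1 x) μ := by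
    intro D hD
    have h := integrable_indicator_one (μ := μ) ((MPAut.measurableSet_image σ hD).inter hC)
    refine h.congr (Eventually.of_forall fun x => ?_)
    rw [Set.inter_indicator_one]
    simp only [Pi.mul_apply, MPAut.indicator_image σ]
  have hval : ∀ D : Set X, MeasurableSet D →
      μ.real (σ.1 '' D ∩ C) = ∫ x, D.indicator (1 : X → ℝ) (σ.1.symm x) * C.indicator 1 x ∂μ := by
    intro D hD
    rw [measureReal_inter_eq_integral (MPAut.measurableSet_image σ hD) hC]
    simp only [MPAut.indicator_image σ]
  have hd : Integrable (fun x => |B.indicator 1 x -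
      c.sum fun i r => r * (A i).indicator (1 : X → ℝ) x|) μ :=
    ((integrable_indicator_one hB).sub (integrable_sum_indicator hA.1 c)).abs
  have hsum : (c.sum fun i r => r * μ.real (σ.1 '' A i ∩ C)) =
      ∫ x, c.sum fun i r =>
        r * ((A i).indicator (1 : X → ℝ) (σ.1.symm x) * C.indicator 1 x) ∂μ := by
    simp only [Finsupp.sum]
    rw [integral_finsetSum _ fun i _ => (hbi (A i) (hA.1 i)).const_mul _]
    exact Finset.sum_congr rfl fun i _ => by rw [hval _ (hA.1 i), integral_const_mul]
  have hsi : Integrable (fun x => c.sum fun i r =>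
        r * ((A i).indicator (1 : X → ℝ) (σ.1.symm x) * C.indicator 1 x)) μ :=
    integrable_finsetSum _ fun i _ => (hbi (A i) (hA.1 i)).const_mul _
  rw [hval B hB, hsum, ← integral_sub (hbi B hB) hsi]
  refine (abs_integral_le_integral_abs).trans (le_trans ?_ hc.le)
  -- Invariance of the integral makes the L¹ error the same for every transformation, which gives
  -- the uniformity.
  rw [← MPAut.integral_comp_symm σ hd]
  refine integral_mono ((hbi B hB).sub hsi).abs
    (σ.2.2.integrable_comp_of_integrable hd) fun x => ?_
  have h1 : (c.sum fun i r =>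
        r * ((A i).indicator (1 : X → ℝ) (σ.1.symm x) * C.indicator 1 x)) =
      (c.sum fun i r => r * (A i).indicator (1 : X → ℝ) (σ.1.symm x)) * C.indicator 1 x := by
    simp only [Finsupp.sum, Finset.sum_mul, mul_assoc]
  change |_ - _| ≤ |_ - _|
  rw [h1, ← sub_mul, abs_mul]
  refine mul_le_of_le_one_right (abs_nonneg _) ?_
  by_cases h : x ∈ C <;> simp [h]

/-- The discrepancy on a measurable set is controlled by the discrepancies on a generating
family. -/
theorem exists_discrepancy_approx {A : ℕ → Set X} (hA : IsGeneratingFamily μ A) {B : Set X}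
    (hB : MeasurableSet B) {ε : ℝ} (hε : 0 < ε) :
    ∃ c : ℕ →₀ ℝ, ∀ T S : Transf μ,
      discrepancy T S B ≤ ε + c.sum fun i r => |r| * discrepancy T S (A i) := by
  obtain ⟨c, hc⟩ := hA.2 B hB (ε / 2) (half_pos hε)
  refine ⟨c, fun T S => ?_⟩
  induction T using Quotient.inductionOn' with | _ σ
  induction S using Quotient.inductionOn' with | _ τ
  change μ.real ((σ.1 '' B) ∆ (τ.1 '' B)) ≤
    ε + c.sum fun i r => |r| * μ.real ((σ.1 '' A i) ∆ (τ.1 '' A i))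
  set f : X → ℝ := fun x => c.sum fun i r => r * (A i).indicator (1 : X → ℝ) x with hf
  have hfi : Integrable f μ := integrable_sum_indicator hA.1 c
  have hd : Integrable (fun x => |B.indicator 1 x - f x|) μ :=
    ((integrable_indicator_one hB).sub hfi).abs
  have hval : ∀ D : Set X, MeasurableSet D → μ.real ((σ.1 '' D) ∆ (τ.1 '' D)) =
      ∫ x, |D.indicator (1 : X → ℝ) (σ.1.symm x) - D.indicator 1 (τ.1.symm x)| ∂μ := by
    intro D hD
    rw [measureReal_symmDiff_eq_integral (MPAut.measurableSet_image σ hD) (MPAut.measurableSet_image τ hD)]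
    simp only [MPAut.indicator_image]
  have hdi : ∀ D : Set X, MeasurableSet D → Integrable (fun x =>
      |D.indicator (1 : X → ℝ) (σ.1.symm x) - D.indicator 1 (τ.1.symm x)|) μ := fun D hD =>
    ((σ.2.2.integrable_comp_of_integrable (integrable_indicator_one hD)).sub
      (τ.2.2.integrable_comp_of_integrable (integrable_indicator_one hD))).abs
  have hsi : Integrable (fun x => c.sum fun i r =>
      |r| * |(A i).indicator (1 : X → ℝ) (σ.1.symm x) - (A i).indicator 1 (τ.1.symm x)|) μ :=
    integrable_finsetSum _ fun i _ => (hdi (A i) (hA.1 i)).const_mul _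
  have hsum : (c.sum fun i r => |r| * μ.real ((σ.1 '' A i) ∆ (τ.1 '' A i))) =
      ∫ x, c.sum fun i r => |r| *
        |(A i).indicator (1 : X → ℝ) (σ.1.symm x) - (A i).indicator 1 (τ.1.symm x)| ∂μ := by
    simp only [Finsupp.sum]
    rw [integral_finsetSum _ fun i _ => (hdi (A i) (hA.1 i)).const_mul _]
    exact Finset.sum_congr rfl fun i _ => by rw [hval _ (hA.1 i), integral_const_mul]
  have hσi : Integrable (fun x => |B.indicator 1 (σ.1.symm x) - f (σ.1.symm x)|) μ :=
    σ.2.2.integrable_comp_of_integrable hd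
  have hτi : Integrable (fun x => |B.indicator 1 (τ.1.symm x) - f (τ.1.symm x)|) μ :=
    τ.2.2.integrable_comp_of_integrable hd
  have hadd : Integrable (fun x => |B.indicator 1 (σ.1.symm x) - f (σ.1.symm x)| +
      |B.indicator 1 (τ.1.symm x) - f (τ.1.symm x)|) μ := hσi.add hτi
  have hσ := MPAut.integral_comp_symm σ hd
  have hτ := MPAut.integral_comp_symm τ hd
  calc μ.real ((σ.1 '' B) ∆ (τ.1 '' B))
      ≤ ∫ x, ((|B.indicator 1 (σ.1.symm x) - f (σ.1.symm x)| +
          |B.indicator 1 (τ.1.symm x) - f (τ.1.symm x)|) + c.sum fun i r => |r| *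
        |(A i).indicator (1 : X → ℝ) (σ.1.symm x) - (A i).indicator 1 (τ.1.symm x)|) ∂μ := by
        rw [hval B hB]
        refine integral_mono (hdi B hB) (hadd.add hsi) fun x => ?_
        have h1 : |f (σ.1.symm x) - f (τ.1.symm x)| ≤ c.sum fun i r => |r| *
            |(A i).indicator (1 : X → ℝ) (σ.1.symm x) - (A i).indicator 1 (τ.1.symm x)| := by
          simp only [hf, Finsupp.sum, ← Finset.sum_sub_distrib, ← mul_sub]
          refine (Finset.abs_sum_le_sum_abs _ _).trans_eq ?_
          simp only [abs_mul]
        have h2 := abs_sub_le (B.indicator 1 (σ.1.symm x)) (f (σ.1.symm x)) (f (τ.1.symm x))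
        have h3 := abs_sub_le (B.indicator (1 : X → ℝ) (σ.1.symm x)) (f (τ.1.symm x))
          (B.indicator 1 (τ.1.symm x))
        rw [abs_sub_comm (f (τ.1.symm x))] at h3
        dsimp only
        linarith
    _ ≤ ε + c.sum fun i r => |r| * μ.real ((σ.1 '' A i) ∆ (τ.1 '' A i)) := by
        rw [integral_add hadd hsi, integral_add hσi hτi, hsum]
        have : ∫ x, |B.indicator 1 x - f x| ∂μ < ε / 2 := hc
        linarith

/-- Exchanges the two sets, so that an approximation in the first argument also serves in the
second. -/
theorem overlap_inv {T : Transf μ} {B C : Set X} (hB : MeasurableSet B) (hC : MeasurableSet C) :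
    overlap T⁻¹ B C = overlap T C B := by
  induction T using Quotient.inductionOn' with | _ σ
  change μ.real (σ.1.symm '' B ∩ C) = μ.real (σ.1 '' C ∩ B)
  rw [Equiv.image_symm_eq_preimage, ← MPAut.measureReal_image σ ((σ.2.1.measurable hB).inter hC),
    Set.image_inter σ.1.injective, Equiv.image_preimage, Set.inter_comm]

end Approximation

/-! ### Convergence in the lead metric in terms of sets -/

section Convergence

variable {X : Type*} [MeasurableSpace X] {μ : Measure X} [IsProbabilityMeasure μ]
  {G : Type*} [Group G] {A : ℕ → Set X} {ℓ : G → ℝ}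

theorem discrepancy_le_weakDist (A : ℕ → Set X) (T S : Transf μ) (i : ℕ) :
    discrepancy T S (A i) ≤ 2 ^ (i + 1) * weakDist A T S := by
  have h1 := (weakDist_summable A T S).le_tsum i fun j _ => by
    have h1 := discrepancy_nonneg T S (A j)
    have h2 := discrepancy_nonneg T⁻¹ S⁻¹ (A j)
    positivity
  have h2 := discrepancy_nonneg T⁻¹ S⁻¹ (A i)
  have h3 : (1 : ℝ) / 2 ^ (i + 1) * discrepancy T S (A i) ≤ weakDist A T S :=
    le_trans (mul_le_mul_of_nonneg_left (by linarith) (by positivity)) h1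
  have h4 := mul_le_mul_of_nonneg_left h3 (by positivity : (0 : ℝ) ≤ 2 ^ (i + 1))
  rwa [← mul_assoc, mul_one_div_cancel (by positivity), one_mul] at h4

theorem abs_overlap_sub_le_overlapDist (A : ℕ → Set X) (T S : Transf μ) (i j : ℕ) :
    |overlap T (A i) (A j) - overlap S (A i) (A j)| ≤
      2 ^ ((i + 1) + (j + 1)) * overlapDist A T S := by
  have h3 : (1 : ℝ) / 2 ^ ((i + 1) + (j + 1)) *
      |overlap T (A i) (A j) - overlap S (A i) (A j)| ≤ overlapDist A T S :=
    (overlapDist_summable A T S).le_tsum (i, j) fun p _ => by positivity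
  have h4 := mul_le_mul_of_nonneg_left h3 (by positivity : (0 : ℝ) ≤ 2 ^ ((i + 1) + (j + 1)))
  rwa [← mul_assoc, mul_one_div_cancel (by positivity), one_mul] at h4

theorem overlapDist_le_leadDist (A : ℕ → Set X) (ℓ : G → ℝ) (T S : G →* Transf μ) (g : G) :
    overlapDist A (T g) (S g) ≤ leadDist A ℓ T S :=
  (le_ciSup (overlapDist_bddAbove A T S) g).trans
    (le_add_of_nonneg_left (actionDist_nonneg A ℓ T S))

theorem weakDist_le_leadDist (A : ℕ → Set X) (hℓ : Summable fun g => 1 / (2 : ℝ) ^ ℓ g)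
    (T S : G →* Transf μ) (g : G) :
    weakDist A (T g) (S g) ≤ (2 : ℝ) ^ ℓ g * leadDist A ℓ T S := by
  have h1 : 1 / (2 : ℝ) ^ ℓ g * weakDist A (T g) (S g) ≤ actionDist A ℓ T S :=
    (actionDist_summable A hℓ T S).le_tsum g fun h _ =>
      mul_nonneg (by positivity) (weakDist_nonneg _ _ _)
  have h2 : actionDist A ℓ T S ≤ leadDist A ℓ T S :=
    le_add_of_nonneg_right (Real.iSup_nonneg fun g => overlapDist_nonneg A (T g) (S g))
  have h4 := mul_le_mul_of_nonneg_left (h1.trans h2) (by positivity : (0 : ℝ) ≤ (2 : ℝ) ^ ℓ g)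
  rwa [← mul_assoc, mul_one_div_cancel (by positivity), one_mul] at h4

variable {ι : Type*} {l : Filter ι} {T S : ι → G →* Transf μ}

/-- Convergence in the lead metric, tested on a sequence of sets. -/
theorem tendsto_leadDist (hℓ : Summable fun g => 1 / (2 : ℝ) ^ ℓ g)
    (hd : ∀ g i, Tendsto (fun n => discrepancy (T n g) (S n g) (A i)) l (𝓝 0))
    (ho : ∀ i j, ∀ ε > 0, ∀ᶠ n in l, ∀ g,
      |overlap (T n g) (A i) (A j) - overlap (S n g) (A i) (A j)| ≤ ε) :
    Tendsto (fun n => leadDist A ℓ (T n) (S n)) l (𝓝 0) := by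
  have hw : ∀ g, Tendsto (fun n => weakDist A (T n g) (S n g)) l (𝓝 0) := by
    intro g
    have h0 : (0 : ℝ) = ∑' i : ℕ, 0 := tsum_zero.symm
    rw [h0]
    refine tendsto_tsum_of_dominated_convergence (summable_weight.mul_right 2) (fun i => ?_)
      (Eventually.of_forall fun n i => ?_)
    · have h1 := hd g i
      -- The inverse term at g is the forward term at g⁻¹.
      have h2 : Tendsto (fun n => discrepancy (T n g)⁻¹ (S n g)⁻¹ (A i)) l (𝓝 0) := by
        simpa only [map_inv] using hd g⁻¹ i
      simpa using (h1.add h2).const_mul ((1 : ℝ) / 2 ^ (i + 1))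
    · have h1 := discrepancy_nonneg (T n g) (S n g) (A i)
      have h2 := discrepancy_nonneg (T n g)⁻¹ (S n g)⁻¹ (A i)
      have h3 := discrepancy_le_one (T n g) (S n g) (A i)
      have h4 := discrepancy_le_one (T n g)⁻¹ (S n g)⁻¹ (A i)
      rw [Real.norm_of_nonneg (by positivity)]
      gcongr
      linarith
  have ha : Tendsto (fun n => actionDist A ℓ (T n) (S n)) l (𝓝 0) := by
    have h0 : (0 : ℝ) = ∑' g : G, 0 := tsum_zero.symm
    rw [h0]
    refine tendsto_tsum_of_dominated_convergence
      (hℓ.mul_right (∑' i : ℕ, (1 : ℝ) / 2 ^ (i + 1) * 2)) (fun g => ?_)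
      (Eventually.of_forall fun n g => ?_)
    · simpa using (hw g).const_mul (1 / (2 : ℝ) ^ ℓ g)
    · rw [Real.norm_of_nonneg (mul_nonneg (by positivity) (weakDist_nonneg _ _ _))]
      exact mul_le_mul_of_nonneg_left (weakDist_le A _ _) (by positivity)
  -- The supremum over g is moved inside the double series. This majorant tends to zero termwise by
  -- the uniform hypothesis, and dominated convergence applies to it.
  set u : ι → ℕ × ℕ → ℝ := fun n p =>
    ⨆ g, |overlap (T n g) (A p.1) (A p.2) - overlap (S n g) (A p.1) (A p.2)| with hu
  have hub : ∀ (n : ι) (p : ℕ × ℕ), BddAbove (Set.range fun g =>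
      |overlap (T n g) (A p.1) (A p.2) - overlap (S n g) (A p.1) (A p.2)|) := fun n p =>
    ⟨1, by rintro _ ⟨g, rfl⟩; exact abs_overlap_sub_le _ _ _ _⟩
  have hu0 : ∀ n p, 0 ≤ u n p := fun n p => Real.iSup_nonneg fun g => abs_nonneg _
  have hu1 : ∀ n p, u n p ≤ 1 := fun n p => ciSup_le fun g => abs_overlap_sub_le _ _ _ _
  have hut : Tendsto (fun n => ∑' p : ℕ × ℕ, (1 : ℝ) / 2 ^ ((p.1 + 1) + (p.2 + 1)) * u n p) l
      (𝓝 0) := by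
    have h0 : (0 : ℝ) = ∑' p : ℕ × ℕ, 0 := tsum_zero.symm
    rw [h0]
    refine tendsto_tsum_of_dominated_convergence summable_weight_prod (fun p => ?_)
      (Eventually.of_forall fun n p => ?_)
    · have h1 : Tendsto (fun n => u n p) l (𝓝 0) := by
        rw [Metric.tendsto_nhds]
        intro ε hε
        filter_upwards [ho p.1 p.2 (ε / 2) (half_pos hε)] with n hn
        rw [Real.dist_0_eq_abs, abs_of_nonneg (hu0 n p)]
        exact lt_of_le_of_lt (ciSup_le hn) (half_lt_self hε)
      simpa using h1.const_mul ((1 : ℝ) / 2 ^ ((p.1 + 1) + (p.2 + 1)))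
    · rw [Real.norm_of_nonneg (mul_nonneg (by positivity) (hu0 n p))]
      exact mul_le_of_le_one_right (by positivity) (hu1 n p)
  have hs : Tendsto (fun n => ⨆ g : G, overlapDist A (T n g) (S n g)) l (𝓝 0) := by
    refine squeeze_zero (fun n => Real.iSup_nonneg fun g => overlapDist_nonneg _ _ _)
      (fun n => ciSup_le fun g => ?_) hut
    refine Summable.tsum_le_tsum (fun p => ?_) (overlapDist_summable A _ _)
      (Summable.of_nonneg_of_le (fun p => mul_nonneg (by positivity) (hu0 n p))
        (fun p => mul_le_of_le_one_right (by positivity) (hu1 n p)) summable_weight_prod)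
    exact mul_le_mul_of_nonneg_left (le_ciSup (hub n p) g) (by positivity)
  simpa [leadDist] using ha.add hs

/-- Arbitrary measurable sets are needed because conjugation by u replaces each Aᵢ by its image
under u. -/
theorem tendsto_discrepancy_of_leadDist (hA : IsGeneratingFamily μ A)
    (hℓ : Summable fun g => 1 / (2 : ℝ) ^ ℓ g)
    (h : Tendsto (fun n => leadDist A ℓ (T n) (S n)) l (𝓝 0)) {B : Set X}
    (hB : MeasurableSet B) (g : G) :
    Tendsto (fun n => discrepancy (T n g) (S n g) B) l (𝓝 0) := by
  have hAi : ∀ i, Tendsto (fun n => discrepancy (T n g) (S n g) (A i)) l (𝓝 0) := by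
    intro i
    refine squeeze_zero (fun n => discrepancy_nonneg _ _ _)
      (fun n => (discrepancy_le_weakDist A _ _ i).trans
        (mul_le_mul_of_nonneg_left (weakDist_le_leadDist A hℓ (T n) (S n) g) (by positivity))) ?_
    simpa using (h.const_mul ((2 : ℝ) ^ ℓ g)).const_mul ((2 : ℝ) ^ (i + 1))
  rw [Metric.tendsto_nhds]
  intro ε hε
  obtain ⟨c, hc⟩ := exists_discrepancy_approx hA hB (half_pos hε)
  have hsum : Tendsto (fun n => c.sum fun i r => |r| * discrepancy (T n g) (S n g) (A i)) l
      (𝓝 0) := by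
    have h1 : Tendsto (fun n => c.sum fun i r => |r| * discrepancy (T n g) (S n g) (A i)) l
        (𝓝 (c.sum fun _ r => |r| * 0)) :=
      tendsto_finsetSum _ fun i _ => (hAi i).const_mul _
    simpa [Finsupp.sum] using h1
  filter_upwards [hsum.eventually (gt_mem_nhds (half_pos hε))] with n hn
  rw [Real.dist_0_eq_abs, abs_of_nonneg (discrepancy_nonneg _ _ _)]
  linarith [hc (T n g) (S n g)]

/-- A three-epsilon argument: the coefficients depend neither on n nor on g, so uniformity in g
survives. -/
theorem eventually_overlap_of_approx {ν : Type*} {u v : ι → ν → ℝ} {p q : ℕ → ι → ν → ℝ}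
    (hpq : ∀ i, ∀ ε > 0, ∀ᶠ n in l, ∀ g, |p i n g - q i n g| ≤ ε)
    (happ : ∀ ε > 0, ∃ c : ℕ →₀ ℝ, ∀ n g, |u n g - c.sum fun i r => r * p i n g| ≤ ε ∧
      |v n g - c.sum fun i r => r * q i n g| ≤ ε) :
    ∀ ε > 0, ∀ᶠ n in l, ∀ g, |u n g - v n g| ≤ ε := by
  intro ε hε
  obtain ⟨c, hc⟩ := happ (ε / 3) (by positivity)
  -- Adding 1 keeps the divisor positive when all coefficients vanish.
  set K : ℝ := (c.sum fun _ r => |r|) + 1 with hK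
  have hK0 : 0 ≤ c.sum fun _ r => |r| := Finset.sum_nonneg fun _ _ => abs_nonneg _
  have hKp : 0 < K := by linarith
  have hev : ∀ᶠ n in l, ∀ i ∈ c.support, ∀ g, |p i n g - q i n g| ≤ ε / 3 / K :=
    (Filter.eventually_all_finset _).2 fun i _ => hpq i _ (by positivity)
  filter_upwards [hev] with n hn g
  have h1 : |(c.sum fun i r => r * p i n g) - c.sum fun i r => r * q i n g| ≤ ε / 3 := by
    simp only [Finsupp.sum, ← Finset.sum_sub_distrib, ← mul_sub]
    calc |∑ i ∈ c.support, c i * (p i n g - q i n g)|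
        ≤ ∑ i ∈ c.support, |c i| * (ε / 3 / K) := by
          refine (Finset.abs_sum_le_sum_abs _ _).trans (Finset.sum_le_sum fun i hi => ?_)
          rw [abs_mul]
          exact mul_le_mul_of_nonneg_left (hn i hi g) (abs_nonneg _)
      _ = (c.sum fun _ r => |r|) * (ε / 3 / K) := by rw [← Finset.sum_mul]; rfl
      _ ≤ K * (ε / 3 / K) := by gcongr; linarith
      _ = ε / 3 := by field_simp
  obtain ⟨h2, h3⟩ := hc n g
  rw [abs_le] at h1 h2 h3 ⊢
  constructor <;> linarith [h1.1, h1.2, h2.1, h2.2, h3.1, h3.2]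

/-- The generating sets are replaced by arbitrary ones one argument at a time, the second argument
by passing to inverses. -/
theorem eventually_overlap_of_leadDist (hA : IsGeneratingFamily μ A)
    (h : Tendsto (fun n => leadDist A ℓ (T n) (S n)) l (𝓝 0)) {B C : Set X}
    (hB : MeasurableSet B) (hC : MeasurableSet C) :
    ∀ ε > 0, ∀ᶠ n in l, ∀ g, |overlap (T n g) B C - overlap (S n g) B C| ≤ ε := by
  have h1 : ∀ i j, ∀ ε > 0, ∀ᶠ n in l, ∀ g,
      |overlap (T n g) (A i) (A j) - overlap (S n g) (A i) (A j)| ≤ ε := by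
    intro i j ε hε
    have h0 : Tendsto (fun n => (2 : ℝ) ^ ((i + 1) + (j + 1)) * leadDist A ℓ (T n) (S n)) l
        (𝓝 0) := by
      simpa using h.const_mul ((2 : ℝ) ^ ((i + 1) + (j + 1)))
    filter_upwards [h0.eventually (gt_mem_nhds hε)] with n hn g
    refine (abs_overlap_sub_le_overlapDist A _ _ i j).trans (le_trans ?_ hn.le)
    exact mul_le_mul_of_nonneg_left (overlapDist_le_leadDist A ℓ _ _ g) (by positivity)
  have h2 : ∀ i, ∀ ε > 0, ∀ᶠ n in l, ∀ g,
      |overlap (T n g) (A i) C - overlap (S n g) (A i) C| ≤ ε := by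
    intro i
    refine eventually_overlap_of_approx (h1 i) fun ε hε => ?_
    obtain ⟨c, hc⟩ := exists_overlap_approx hA hC hε
    have hc' : ∀ R : Transf μ,
        |overlap R (A i) C - c.sum fun j r => r * overlap R (A i) (A j)| ≤ ε := by
      intro R
      have h3 := hc R⁻¹ (A i) (hA.1 i)
      rw [overlap_inv hC (hA.1 i)] at h3
      simpa only [overlap_inv (hA.1 _) (hA.1 i)] using h3
    exact ⟨c, fun n g => ⟨hc' _, hc' _⟩⟩
  refine eventually_overlap_of_approx h2 fun ε hε => ?_
  obtain ⟨c, hc⟩ := exists_overlap_approx hA hB hε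
  exact ⟨c, fun n g => ⟨hc _ _ hC, hc _ _ hC⟩⟩

end Convergence

/-! ### Conjugation and its continuity -/

section Conjugation

variable {X : Type*} [MeasurableSpace X] {μ : Measure X} [IsProbabilityMeasure μ]
  {G : Type*} [Group G]

theorem overlap_conj (u : MPAut μ) (T : Transf μ) {B C : Set X} (hB : MeasurableSet B)
    (hC : MeasurableSet C) :
    overlap ((QuotientGroup.mk u : Transf μ)⁻¹ * T * QuotientGroup.mk u) B C = overlap T (u.1 '' B) (u.1 '' C) := by
  induction T using Quotient.inductionOn' with | _ σ
  change μ.real ((fun x => u.1.symm (σ.1 (u.1 x))) '' B ∩ C) =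
    μ.real (σ.1 '' (u.1 '' B) ∩ u.1 '' C)
  have h : u.1 '' ((fun x => u.1.symm (σ.1 (u.1 x))) '' B ∩ C) =
      σ.1 '' (u.1 '' B) ∩ u.1 '' C := by
    rw [Set.image_inter u.1.injective]
    simp only [Set.image_image, Equiv.apply_symm_apply]
  have hm : MeasurableSet ((fun x => u.1.symm (σ.1 (u.1 x))) '' B) :=
    MPAut.measurableSet_image (u⁻¹ * σ * u) hB
  rw [← h, MPAut.measureReal_image u (hm.inter hC)]

theorem discrepancy_conj (u : MPAut μ) (T S : Transf μ) {B : Set X} (hB : MeasurableSet B) :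
    discrepancy ((QuotientGroup.mk u : Transf μ)⁻¹ * T * QuotientGroup.mk u) ((QuotientGroup.mk u : Transf μ)⁻¹ * S * QuotientGroup.mk u) B =
      discrepancy T S (u.1 '' B) := by
  induction T using Quotient.inductionOn' with | _ σ
  induction S using Quotient.inductionOn' with | _ τ
  change μ.real (((fun x => u.1.symm (σ.1 (u.1 x))) '' B) ∆
    ((fun x => u.1.symm (τ.1 (u.1 x))) '' B)) =
    μ.real ((σ.1 '' (u.1 '' B)) ∆ (τ.1 '' (u.1 '' B)))
  have h : u.1 '' (((fun x => u.1.symm (σ.1 (u.1 x))) '' B) ∆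
      ((fun x => u.1.symm (τ.1 (u.1 x))) '' B)) =
      (σ.1 '' (u.1 '' B)) ∆ (τ.1 '' (u.1 '' B)) := by
    rw [Set.image_symmDiff u.1.injective]
    simp only [Set.image_image, Equiv.apply_symm_apply]
  have hm : ∀ ρ : MPAut μ, MeasurableSet ((fun x => u.1.symm (ρ.1 (u.1 x))) '' B) :=
    fun ρ => MPAut.measurableSet_image (u⁻¹ * ρ * u) hB
  rw [← h, MPAut.measureReal_image u ((hm σ).symmDiff (hm τ))]

/-- The conjugate action `U⁻¹ T U`. -/
def conjAction (u : MPAut μ) (T : MixingAction G μ) : MixingAction G μ :=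
  ⟨(MulAut.conj (QuotientGroup.mk u : Transf μ)⁻¹).toMonoidHom.comp T.1, fun B C hB hC => by
    have h := T.2 (u.1 '' B) (u.1 '' C) (MPAut.measurableSet_image u hB)
      (MPAut.measurableSet_image u hC)
    rw [MPAut.measureReal_image u hB, MPAut.measureReal_image u hC] at h
    refine h.congr fun g => ?_
    rw [← overlap_conj u (T.1 g) hB hC]
    have h2 := MulAut.conj_apply (QuotientGroup.mk u : Transf μ)⁻¹ (T.1 g)
    rw [inv_inv] at h2
    exact congrArg (overlap · B C) h2.symm⟩

theorem conjAction_apply (u : MPAut μ) (T : MixingAction G μ) (g : G) :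
    (conjAction u T).1 g = (QuotientGroup.mk u : Transf μ)⁻¹ * T.1 g * QuotientGroup.mk u := by
  change (QuotientGroup.mk u : Transf μ)⁻¹ * T.1 g * (QuotientGroup.mk u : Transf μ)⁻¹⁻¹ = _
  rw [inv_inv]

theorem mem_conjClass_iff {T S : MixingAction G μ} :
    S ∈ conjClass T ↔ ∃ u : MPAut μ, S = conjAction u T := by
  constructor
  · rintro ⟨U, hU⟩
    obtain ⟨u, rfl⟩ := QuotientGroup.mk_surjective U
    exact ⟨u, Subtype.ext (MonoidHom.ext fun g => (hU g).trans (conjAction_apply u T g).symm)⟩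
  · rintro ⟨u, rfl⟩
    exact ⟨QuotientGroup.mk u, conjAction_apply u T⟩

theorem conjClass_eq_of_mem {T S : MixingAction G μ} (h : S ∈ conjClass T) :
    conjClass S = conjClass T := by
  obtain ⟨U, hU⟩ := h
  ext R
  constructor
  · rintro ⟨V, hV⟩
    exact ⟨U * V, fun g => by rw [hV, hU]; group⟩
  · rintro ⟨V, hV⟩
    exact ⟨U⁻¹ * V, fun g => by rw [hV, hU]; group⟩

/-- Testing conjugates on the Aᵢ amounts to testing the original actions on the images of the Aᵢ,
and convergence in the lead metric controls all measurable sets. -/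
theorem continuous_conjAction [StandardBorelSpace X] {A : ℕ → Set X}
    (hA : IsGeneratingFamily μ A) {ℓ : G → ℝ} (hℓ : Summable fun g => 1 / (2 : ℝ) ^ ℓ g)
    (u : MPAut μ) :
    letI : MetricSpace (MixingAction G μ) := leadMetricSpace G μ A hA ℓ hℓ
    Continuous (conjAction (G := G) u) := by
  let _ : MetricSpace (MixingAction G μ) := leadMetricSpace G μ A hA ℓ hℓ
  refine continuous_iff_continuousAt.2 fun S => ?_
  refine tendsto_iff_dist_tendsto_zero.2 ?_
  have h : Tendsto (fun T : MixingAction G μ => leadDist A ℓ T.1 S.1) (𝓝 S) (𝓝 0) :=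
    tendsto_iff_dist_tendsto_zero.1 (tendsto_id (x := 𝓝 S))
  have hm : ∀ i, MeasurableSet (u.1 '' A i) := fun i => MPAut.measurableSet_image u (hA.1 i)
  refine tendsto_leadDist (T := fun T : MixingAction G μ => (conjAction u T).1)
    (S := fun _ => (conjAction u S).1) hℓ (fun g i => ?_) (fun i j => ?_)
  · simp only [conjAction_apply, discrepancy_conj u _ _ (hA.1 i)]
    exact tendsto_discrepancy_of_leadDist hA hℓ h (hm i) g
  · simp only [conjAction_apply, overlap_conj u _ (hA.1 i) (hA.1 j)]
    exact eventually_overlap_of_leadDist hA h (hm i) (hm j)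

end Conjugation

/-! ### Separability of the space of mixing actions -/

section Separability

variable {X : Type*} [MeasurableSpace X] {μ : Measure X} [IsProbabilityMeasure μ]
  {G : Type*} [Group G]

/-- The code is the index of a nearby member of a countable dense family in the measure algebra. -/
theorem exists_discrepancy_code [MeasurableSpace.CountablyGenerated X] {B : Set X}
    (hB : MeasurableSet B) {ε : ℝ} (hε : 0 < ε) :
    ∃ c : Transf μ → ℕ, ∀ T S, c T = c S → discrepancy T S B ≤ ε := by
  obtain ⟨𝒜, h𝒜c, h𝒜⟩ := exists_countable_measureDense μ
  obtain ⟨D, rfl⟩ := h𝒜c.exists_eq_range h𝒜.nonempty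
  have h1 : ∀ T : Transf μ, ∃ n, μ ((T.out.1 '' B) ∆ D n) < ENNReal.ofReal (ε / 2) := by
    intro T
    obtain ⟨_, ⟨n, rfl⟩, hn⟩ := h𝒜.approx (T.out.1 '' B) (MPAut.measurableSet_image _ hB)
      (measure_ne_top _ _) (ε / 2) (half_pos hε)
    exact ⟨n, hn⟩
  choose c hc using h1
  refine ⟨c, fun T S hTS => ?_⟩
  have h2 : ∀ T : Transf μ, μ.real ((T.out.1 '' B) ∆ D (c T)) ≤ ε / 2 := fun T =>
    ENNReal.toReal_le_of_le_ofReal (half_pos hε).le (hc T).le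
  have h3 : discrepancy T S B = μ.real ((T.out.1 '' B) ∆ (S.out.1 '' B)) := by
    conv_lhs => rw [← Quotient.out_eq' T, ← Quotient.out_eq' S]
    rfl
  have h4 := h2 T
  have h5 := h2 S
  rw [h3]
  rw [← hTS, symmDiff_comm] at h5
  have h6 := measureReal_symmDiff_le (μ := μ) (s := T.out.1 '' B) (t := D (c T)) (S.out.1 '' B)
  linarith

/-- Mixing is essential here. The deviation of the overlap from its limit, rounded in units of ε,
vanishes off a finite set of g. Hence the code lies in a countable set when the group is countable,
although the estimate is uniform over the group. -/
theorem exists_overlap_code {B C : Set X} (hB : MeasurableSet B) (hC : MeasurableSet C) {ε : ℝ}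
    (hε : 0 < ε) :
    ∃ c : MixingAction G μ → (G →₀ ℤ), ∀ T S, c T = c S →
      ∀ g, |overlap (T.1 g) B C - overlap (S.1 g) B C| ≤ ε := by
  have hfin : ∀ T : MixingAction G μ, (Function.support fun g =>
      round ((overlap (T.1 g) B C - μ.real B * μ.real C) / ε)).Finite := by
    intro T
    have h1 := (Metric.tendsto_nhds.1 (T.2 B C hB hC)) (ε / 2) (half_pos hε)
    rw [Filter.eventually_cofinite] at h1
    refine h1.subset fun g hg hlt => hg ?_
    rw [Real.dist_eq, abs_lt] at hlt
    refine round_eq_zero_iff.2 ⟨?_, ?_⟩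
    · rw [le_div_iff₀ hε]; linarith [hlt.1]
    · rw [div_lt_iff₀ hε]; linarith [hlt.2]
  refine ⟨fun T => Finsupp.ofSupportFinite _ (hfin T), fun T S hTS g => ?_⟩
  have h1 : round ((overlap (T.1 g) B C - μ.real B * μ.real C) / ε) =
      round ((overlap (S.1 g) B C - μ.real B * μ.real C) / ε) := DFunLike.congr_fun hTS g
  have h2 := abs_sub_round ((overlap (T.1 g) B C - μ.real B * μ.real C) / ε)
  have h3 := abs_sub_round ((overlap (S.1 g) B C - μ.real B * μ.real C) / ε)
  rw [← h1] at h3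
  rw [abs_le] at h2 h3
  have h4 : overlap (T.1 g) B C - overlap (S.1 g) B C =
      ((overlap (T.1 g) B C - μ.real B * μ.real C) / ε -
        (overlap (S.1 g) B C - μ.real B * μ.real C) / ε) * ε := by
    field_simp
    ring
  rw [h4, abs_mul, abs_of_pos hε]
  refine mul_le_of_le_one_left hε.le (abs_le.2 ⟨?_, ?_⟩) <;>
    linarith [h2.1, h2.2, h3.1, h3.2]

theorem secondCountable_leadMetricSpace [StandardBorelSpace X] [Countable G] {A : ℕ → Set X}
    (hA : IsGeneratingFamily μ A) {ℓ : G → ℝ} (hℓ : Summable fun g => 1 / (2 : ℝ) ^ ℓ g) :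
    letI : MetricSpace (MixingAction G μ) := leadMetricSpace G μ A hA ℓ hℓ
    SecondCountableTopology (MixingAction G μ) := by
  let _ : MetricSpace (MixingAction G μ) := leadMetricSpace G μ A hA ℓ hℓ
  obtain ⟨e, he⟩ := exists_surjective_nat G
  have hpos : ∀ k : ℕ, (0 : ℝ) < 1 / (k + 1) := fun k => Nat.one_div_pos_of_nat
  choose c hc using fun i k => exists_discrepancy_code (μ := μ) (hA.1 i) (hpos k)
  choose o ho using fun i j k => exists_overlap_code (μ := μ) (G := G) (hA.1 i) (hA.1 j) (hpos k)
  let F : ∀ k : ℕ, MixingAction G μ → (Fin k → Fin k → ℕ) × (Fin k → Fin k → (G →₀ ℤ)) :=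
    fun k T => (fun m i => c i k (T.1 (e m)), fun i j => o i j k T)
  -- Pairs of actions with equal code at level k, along k → ∞: convergence of their distance to zero
  -- says that a fine enough code determines an action up to ε.
  let ι := {p : ℕ × MixingAction G μ × MixingAction G μ // F p.1 p.2.1 = F p.1 p.2.2}
  let l : Filter ι := comap (fun p => p.1.1) atTop
  have hl : Tendsto (fun p : ι => p.1.1) l atTop := tendsto_comap
  have hl0 : Tendsto (fun p : ι => (1 : ℝ) / ((p.1.1 : ℕ) + 1)) l (𝓝 0) :=
    tendsto_one_div_add_atTop_nhds_zero_nat.comp hl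
  have hlim : Tendsto (fun p : ι => leadDist A ℓ p.1.2.1.1 p.1.2.2.1) l (𝓝 0) := by
    refine tendsto_leadDist hℓ (fun g i => ?_) (fun i j ε hε => ?_)
    · obtain ⟨m, rfl⟩ := he g
      refine squeeze_zero' (Eventually.of_forall fun p => discrepancy_nonneg _ _ _) ?_ hl0
      filter_upwards [hl.eventually_gt_atTop m, hl.eventually_gt_atTop i] with p hm hi
      exact hc i p.1.1 _ _ (congrFun (congrFun (congrArg Prod.fst p.2) ⟨m, hm⟩) ⟨i, hi⟩)
    · filter_upwards [hl.eventually_gt_atTop i, hl.eventually_gt_atTop j,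
        hl0.eventually (gt_mem_nhds hε)] with p hi hj hp g
      exact (ho i j p.1.1 _ _ (congrFun (congrFun (congrArg Prod.snd p.2) ⟨i, hi⟩) ⟨j, hj⟩)
        g).trans hp.le
  refine Metric.secondCountable_of_countable_discretization fun ε hε => ?_
  have hev := hlim.eventually (gt_mem_nhds hε)
  obtain ⟨k, hk⟩ := eventually_atTop.1 (eventually_comap.1 hev)
  refine ⟨_, Encodable.ofCountable _, F k, fun T S hTS => ?_⟩
  exact (hk k le_rfl ⟨(k, T, S), hTS⟩ rfl).le

end Separability

/-! ### Infinite products of mixing actions -/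

section ProductAction

variable {Y : Type*} [MeasurableSpace Y] {ν : Measure Y} [IsProbabilityMeasure ν]
  {ι : Type*} {l : Filter ι}

/-- Asymptotic independence from all measurable sets follows from that for a generating
π-system. -/
theorem tendsto_measureReal_inter_of_piSystem {𝒮 : Set (Set Y)} (hgen : ‹MeasurableSpace Y› =
    MeasurableSpace.generateFrom 𝒮) (hpi : IsPiSystem 𝒮) {E : ι → Set Y} {b : ℝ}
    (hE : ∀ n, MeasurableSet (E n)) (hb : ∀ n, ν.real (E n) = b)
    (h : ∀ C ∈ 𝒮, Tendsto (fun n => ν.real (E n ∩ C)) l (𝓝 (b * ν.real C)))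
    {C : Set Y} (hC : MeasurableSet C) :
    Tendsto (fun n => ν.real (E n ∩ C)) l (𝓝 (b * ν.real C)) := by
  induction C, hC using MeasurableSpace.induction_on_inter hgen hpi with
  | empty => simpa using tendsto_const_nhds
  | basic C hC => exact h C hC
  | compl C hC ih =>
    have h1 : ∀ n, ν.real (E n ∩ Cᶜ) = b - ν.real (E n ∩ C) := fun n => by
      rw [← hb n, ← measureReal_inter_add_sdiff (s := E n) hC, Set.sdiff_eq]
      ring
    simp only [h1, probReal_compl_eq_one_sub hC, mul_sub, mul_one]
    exact tendsto_const_nhds.sub ih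
  | iUnion D hd hD ih =>
    have h1 : ∀ F : Set Y, MeasurableSet F →
        HasSum (fun i => ν.real (F ∩ D i)) (ν.real (F ∩ ⋃ i, D i)) := by
      intro F hF
      have h2 : ν (F ∩ ⋃ i, D i) = ∑' i, ν (F ∩ D i) := by
        rw [Set.inter_iUnion]
        exact measure_iUnion (fun i j hij => (hd hij).mono Set.inter_subset_right
          Set.inter_subset_right) fun i => hF.inter (hD i)
      rw [measureReal_def, h2]
      have h3 : ∑' i, ν (F ∩ D i) ≠ ⊤ := h2 ▸ measure_ne_top _ _
      have h4 := ENNReal.hasSum_toReal h3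
      rwa [← ENNReal.tsum_toReal_eq fun i => measure_ne_top _ _] at h4
    have h2 := h1 Set.univ MeasurableSet.univ
    simp only [Set.univ_inter] at h2
    have h3 : b * ν.real (⋃ i, D i) = ∑' i, b * ν.real (D i) := by
      rw [tsum_mul_left, h2.tsum_eq]
    rw [h3]
    simp only [← (h1 _ (hE _)).tsum_eq]
    -- The terms are dominated by the measures of the disjoint pieces, whatever the index.
    refine tendsto_tsum_of_dominated_convergence h2.summable ih
      (Eventually.of_forall fun n i => ?_)
    rw [Real.norm_of_nonneg measureReal_nonneg]
    exact measureReal_mono Set.inter_subset_right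

theorem MPAut.measureReal_image_inter (τ : MPAut ν) {B C : Set Y} (hB : MeasurableSet B)
    (hC : MeasurableSet C) : ν.real (τ.1 '' B ∩ C) = ν.real (τ.1 ⁻¹' C ∩ B) := by
  rw [← MPAut.measureReal_image τ ((τ.2.1.measurable hC).inter hB),
    Set.image_inter τ.1.injective, Equiv.image_preimage, Set.inter_comm]

theorem tendsto_overlap_of_piSystem {𝒮 : Set (Set Y)} (hgen : ‹MeasurableSpace Y› =
    MeasurableSpace.generateFrom 𝒮) (hpi : IsPiSystem 𝒮) {τ : ι → MPAut ν}
    (h : ∀ B ∈ 𝒮, ∀ C ∈ 𝒮,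
      Tendsto (fun n => ν.real ((τ n).1 '' B ∩ C)) l (𝓝 (ν.real B * ν.real C)))
    {B C : Set Y} (hB : MeasurableSet B) (hC : MeasurableSet C) :
    Tendsto (fun n => ν.real ((τ n).1 '' B ∩ C)) l (𝓝 (ν.real B * ν.real C)) := by
  have h𝒮 : ∀ D ∈ 𝒮, MeasurableSet D := fun D hD =>
    hgen ▸ MeasurableSpace.measurableSet_generateFrom hD
  have h1 : ∀ B ∈ 𝒮, Tendsto (fun n => ν.real ((τ n).1 '' B ∩ C)) l
      (𝓝 (ν.real B * ν.real C)) := fun B hB =>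
    tendsto_measureReal_inter_of_piSystem hgen hpi
      (fun n => MPAut.measurableSet_image _ (h𝒮 B hB))
      (fun n => MPAut.measureReal_image _ (h𝒮 B hB)) (h B hB) hC
  -- The roles are exchanged: the preimages of `C` have constant measure, so the one-variable lemma
  -- now applies with `B` varying.
  simp only [MPAut.measureReal_image_inter _ hB hC]
  rw [mul_comm]
  refine tendsto_measureReal_inter_of_piSystem hgen hpi (fun n => (τ n).2.1.measurable hC)
    (fun n => (τ n).2.1.measureReal_preimage hC.nullMeasurableSet) (fun D hD => ?_) hB
  simp only [← MPAut.measureReal_image_inter _ (h𝒮 D hD) hC]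
  rw [mul_comm]
  exact h1 D hD

variable {X : Type*} [MeasurableSpace X] {μ : Measure X} [IsProbabilityMeasure μ]

/-- The infinite product of measure preserving transformations. -/
def prodAut (μ : Measure X) [IsProbabilityMeasure μ] :
    (ℕ → MPAut μ) →* MPAut (Measure.infinitePi fun _ : ℕ => μ) where
  toFun σ := ⟨Equiv.piCongrRight fun n => (σ n).1,
    ⟨measurable_pi_lambda _ fun n => (σ n).2.1.measurable.comp (measurable_pi_apply n), by
      have h := Measure.infinitePi_map_pi (μ := fun _ : ℕ => μ) fun n => (σ n).2.1.measurable
      simp only [(σ _).2.1.map_eq] at h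
      exact h⟩,
    ⟨measurable_pi_lambda _ fun n => (σ n).2.2.measurable.comp (measurable_pi_apply n), by
      have h := Measure.infinitePi_map_pi (μ := fun _ : ℕ => μ) fun n => (σ n).2.2.measurable
      simp only [(σ _).2.2.map_eq] at h
      exact h⟩⟩
  map_one' := rfl
  map_mul' _ _ := rfl

theorem prodAut_mem_nullAut {σ : ℕ → MPAut μ} (h : ∀ n, σ n ∈ nullAut μ) :
    prodAut μ σ ∈ nullAut (Measure.infinitePi fun _ : ℕ => μ) := by
  have h1 : ∀ᵐ y ∂(Measure.infinitePi fun _ : ℕ => μ), ∀ n, (σ n).1 (y n) = y n :=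
    ae_all_iff.2 fun n =>
      (measurePreserving_eval_infinitePi (fun _ : ℕ => μ) n).quasiMeasurePreserving.ae (h n)
  change ∀ᵐ y ∂(Measure.infinitePi fun _ : ℕ => μ), (prodAut μ σ).1 y = y
  filter_upwards [h1] with y hy
  exact funext hy

/-- The overlap of two boxes is a finite product of coordinate overlaps, and each factor converges.
-/
theorem tendsto_prodAut_overlap_pi {σ : ι → ℕ → MPAut μ}
    (h : ∀ n, ∀ B C : Set X, MeasurableSet B → MeasurableSet C →
      Tendsto (fun g => μ.real ((σ g n).1 '' B ∩ C)) l (𝓝 (μ.real B * μ.real C)))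
    (s : Finset ℕ) {t u : ℕ → Set X} (ht : ∀ n, MeasurableSet (t n))
    (hu : ∀ n, MeasurableSet (u n)) :
    Tendsto (fun g => (Measure.infinitePi fun _ : ℕ => μ).real
      ((prodAut μ (σ g)).1 '' (s : Set ℕ).pi t ∩ (s : Set ℕ).pi u)) l
      (𝓝 ((Measure.infinitePi fun _ : ℕ => μ).real ((s : Set ℕ).pi t) *
        (Measure.infinitePi fun _ : ℕ => μ).real ((s : Set ℕ).pi u))) := by
  have hbox : ∀ v : ℕ → Set X, (∀ n, MeasurableSet (v n)) →
      (Measure.infinitePi fun _ : ℕ => μ).real ((s : Set ℕ).pi v) = ∏ n ∈ s, μ.real (v n) := by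
    intro v hv
    rw [measureReal_def, Measure.infinitePi_pi _ fun n _ => hv n, ENNReal.toReal_prod]
    rfl
  have himg : ∀ g, (prodAut μ (σ g)).1 '' (s : Set ℕ).pi t ∩ (s : Set ℕ).pi u =
      (s : Set ℕ).pi fun n => (σ g n).1 '' t n ∩ u n := by
    intro g
    ext y
    rw [Equiv.image_eq_preimage_symm]
    simp only [Equiv.image_eq_preimage_symm]
    constructor
    · rintro ⟨h1, h2⟩ n hn
      exact ⟨h1 n hn, h2 n hn⟩
    · intro h1
      exact ⟨fun n hn => (h1 n hn).1, fun n hn => (h1 n hn).2⟩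
  simp only [himg]
  rw [hbox t ht, hbox u hu, ← Finset.prod_mul_distrib]
  simp only [hbox _ fun n => (MPAut.measurableSet_image _ (ht n)).inter (hu n)]
  exact tendsto_finsetProd _ fun n _ => h n _ _ (ht n) (hu n)

/-- Padding with the full space lets two cylinders share one finite index set. -/
theorem exists_pi_eq_pi_of_subset {t : ℕ → Set X} (ht : ∀ n, MeasurableSet (t n))
    {s s' : Finset ℕ} (hs : s ⊆ s') :
    ∃ t' : ℕ → Set X, (∀ n, MeasurableSet (t' n)) ∧ (s : Set ℕ).pi t = (s' : Set ℕ).pi t' := by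
  classical
  refine ⟨fun n => if n ∈ s then t n else Set.univ, fun n => ?_, ?_⟩
  · dsimp only
    split_ifs
    exacts [ht n, MeasurableSet.univ]
  · ext y
    constructor
    · intro h n _
      by_cases hn : n ∈ s
      · simpa [hn] using h n hn
      · simp [hn]
    · intro h n hn
      have hn' : n ∈ s := hn
      simpa [hn'] using h n (hs hn)

theorem tendsto_prodAut_overlap {σ : ι → ℕ → MPAut μ}
    (h : ∀ n, ∀ B C : Set X, MeasurableSet B → MeasurableSet C →
      Tendsto (fun g => μ.real ((σ g n).1 '' B ∩ C)) l (𝓝 (μ.real B * μ.real C)))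
    {B C : Set (ℕ → X)} (hB : MeasurableSet B) (hC : MeasurableSet C) :
    Tendsto (fun g => (Measure.infinitePi fun _ : ℕ => μ).real
      ((prodAut μ (σ g)).1 '' B ∩ C)) l
      (𝓝 ((Measure.infinitePi fun _ : ℕ => μ).real B *
        (Measure.infinitePi fun _ : ℕ => μ).real C)) := by
  refine tendsto_overlap_of_piSystem (τ := fun g => prodAut μ (σ g))
    (generateFrom_squareCylinders (α := fun _ : ℕ => X)).symm
    (isPiSystem_squareCylinders (fun _ => MeasurableSpace.isPiSystem_measurableSet)
      fun _ => MeasurableSet.univ) ?_ hB hC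
  rintro _ ⟨s, t, ht, rfl⟩ _ ⟨s', t', ht', rfl⟩
  obtain ⟨u, hu, hu'⟩ := exists_pi_eq_pi_of_subset (fun n => ht n trivial)
    (Finset.subset_union_left (s₁ := s) (s₂ := s'))
  obtain ⟨v, hv, hv'⟩ := exists_pi_eq_pi_of_subset (fun n => ht' n trivial)
    (Finset.subset_union_right (s₁ := s) (s₂ := s'))
  rw [hu', hv']
  exact tendsto_prodAut_overlap_pi h _ hu hv

/-- The infinite product of actions mod 0. -/
noncomputable def prodAction {G : Type*} [Group G] (T : ℕ → G →* Transf μ) :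
    G →* Transf (Measure.infinitePi fun _ : ℕ => μ) :=
  MonoidHom.mk' (fun g => QuotientGroup.mk (prodAut μ fun n => (T n g).out)) fun g h => by
    rw [← QuotientGroup.mk_mul, ← map_mul, QuotientGroup.eq, ← map_inv, ← map_mul]
    -- The chosen representatives multiply correctly only mod 0 in each coordinate; countably many
    -- null sets are harmless.
    refine prodAut_mem_nullAut fun n => ?_
    have h1 : (QuotientGroup.mk (T n (g * h)).out : Transf μ) =
        QuotientGroup.mk ((T n g).out * (T n h).out) := by
      rw [QuotientGroup.mk_mul, QuotientGroup.out_eq', QuotientGroup.out_eq',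
        QuotientGroup.out_eq', map_mul]
    exact QuotientGroup.eq.1 h1

/-- Transport of measure preserving transformations by an isomorphism of measure spaces. -/
def transportAut (θ : Y ≃ᵐ X) (hθ : MeasurePreserving θ ν μ) : MPAut ν →* MPAut μ where
  toFun τ := ⟨(θ.toEquiv.symm.trans τ.1).trans θ.toEquiv,
    hθ.comp (τ.2.1.comp (hθ.symm θ)), hθ.comp (τ.2.2.comp (hθ.symm θ))⟩
  map_one' := Subtype.ext (Equiv.ext fun x => θ.apply_symm_apply x)
  map_mul' σ τ := Subtype.ext (Equiv.ext fun x =>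
    congrArg (fun y => θ (σ.1 y)) (θ.symm_apply_apply (τ.1 (θ.symm x))).symm)

theorem transportAut_apply (θ : Y ≃ᵐ X) (hθ : MeasurePreserving θ ν μ) (τ : MPAut ν) (x : X) :
    (transportAut θ hθ τ).1 x = θ (τ.1 (θ.symm x)) := rfl

/-- Transport of transformations mod 0 by an isomorphism of measure spaces. -/
def transportTransf (θ : Y ≃ᵐ X) (hθ : MeasurePreserving θ ν μ) : Transf ν →* Transf μ :=
  QuotientGroup.map _ _ (transportAut θ hθ) fun τ hτ => by
    change ∀ᵐ x ∂μ, θ (τ.1 (θ.symm x)) = x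
    filter_upwards [(hθ.symm θ).quasiMeasurePreserving.ae hτ] with x hx
    rw [hx, θ.apply_symm_apply]

theorem overlap_transportTransf (θ : Y ≃ᵐ X) (hθ : MeasurePreserving θ ν μ) (τ : MPAut ν)
    {B C : Set X} (hB : MeasurableSet B) (hC : MeasurableSet C) :
    overlap (transportTransf θ hθ (QuotientGroup.mk τ)) B C =
      ν.real (τ.1 '' (θ ⁻¹' B) ∩ θ ⁻¹' C) := by
  change μ.real ((transportAut θ hθ τ).1 '' B ∩ C) = _
  have h := ((MPAut.measurableSet_image (transportAut θ hθ τ) hB).inter hC).nullMeasurableSet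
    (μ := μ)
  rw [← hθ.measureReal_preimage h, Set.preimage_inter]
  congr 2
  ext y
  rw [Equiv.image_eq_preimage_symm, Equiv.image_eq_preimage_symm]
  change θ (τ.1.symm (θ.symm (θ y))) ∈ B ↔ θ (τ.1.symm y) ∈ B
  rw [θ.symm_apply_apply]

end ProductAction

/-! ### Factors and closures of conjugacy classes -/

section Factor

variable {X : Type*} [MeasurableSpace X] [StandardBorelSpace X] {μ : Measure X}
  [IsProbabilityMeasure μ] [NullSingletonClass μ] {G : Type*} [Group G]

/-- `π` is a factor map from the action `R` onto the action `T`, mod 0. -/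
def IsFactorMap (π : X → X) (R T : G →* Transf μ) : Prop :=
  MeasurePreserving π μ μ ∧ ∀ g, ∃ τ σ : MPAut μ, R g = QuotientGroup.mk τ ∧
    T g = QuotientGroup.mk σ ∧ ∀ x, π (τ.1 x) = σ.1 (π x)

/-- Every sequence of mixing actions consists of factors of one mixing action. -/
theorem exists_common_extension (T : ℕ → MixingAction G μ) :
    ∃ R : MixingAction G μ, ∀ n, ∃ π : X → X, IsFactorMap π R.1 (T n).1 := by
  have hns : NullSingletonClass (Measure.infinitePi fun _ : ℕ => μ) := ⟨fun y => by
    have h := (measurePreserving_eval_infinitePi (fun _ : ℕ => μ) 0).measure_preimage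
      (measurableSet_singleton (y 0)).nullMeasurableSet
    rw [measure_singleton] at h
    refine measure_mono_null ?_ h
    rintro _ rfl
    rfl⟩
  -- With constant labels the relative isomorphism theorem identifies the product space with the
  -- original one.
  obtain ⟨θ, hθ, -⟩ := exists_measurableEquiv_of_distribution
    (Measure.infinitePi fun _ : ℕ => μ) μ (κ := fun _ => 0) (η := fun _ => 0)
    measurable_const measurable_const (by simp [Measure.map_const])
  refine ⟨⟨(transportTransf θ hθ).comp (prodAction fun n => (T n).1), ?_⟩, fun n =>
    ⟨fun x => θ.symm x n, (measurePreserving_eval_infinitePi (fun _ : ℕ => μ) n).comp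
      (hθ.symm θ), fun g => ⟨transportAut θ hθ (prodAut μ fun n => ((T n).1 g).out),
      ((T n).1 g).out, rfl, (QuotientGroup.out_eq' _).symm, fun x => ?_⟩⟩⟩
  · intro B C hB hC
    have h1 : ∀ n, ∀ B C : Set X, MeasurableSet B → MeasurableSet C →
        Tendsto (fun g => μ.real (((T n).1 g).out.1 '' B ∩ C)) cofinite
          (𝓝 (μ.real B * μ.real C)) := by
      intro n B C hB hC
      refine ((T n).2 B C hB hC).congr fun g => ?_
      conv_lhs => rw [← QuotientGroup.out_eq' ((T n).1 g)]
      rfl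
    have h2 := tendsto_prodAut_overlap (σ := fun g n => ((T n).1 g).out) h1
      (θ.measurable hB) (θ.measurable hC)
    rw [hθ.measureReal_preimage hB.nullMeasurableSet,
      hθ.measureReal_preimage hC.nullMeasurableSet] at h2
    exact h2.congr fun g => (overlap_transportTransf θ hθ _ hB hC).symm
  · simp only [transportAut_apply, MeasurableEquiv.symm_apply_apply]
    rfl

/-- Labels each point by its membership pattern, that is, by an atom of the finite algebra generated
by the family. -/
theorem exists_nat_coding {𝒟 : Set (Set X)} (hf : 𝒟.Finite) (hm : ∀ D ∈ 𝒟, MeasurableSet D) :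
    ∃ κ : X → ℕ, Measurable κ ∧ ∀ D ∈ 𝒟, ∃ s : Set ℕ, D = κ ⁻¹' s := by
  classical
  have : Finite 𝒟 := hf
  have : Countable (𝒟 → Bool) := inferInstance
  obtain ⟨e, he⟩ := exists_injective_nat (𝒟 → Bool)
  let b : X → 𝒟 → Bool := fun x D => decide (x ∈ (D : Set X))
  have hb : Measurable b := measurable_pi_lambda _ fun D => by
    refine measurable_to_bool ?_
    convert hm D D.2 using 1
    ext x
    simp [b]
  refine ⟨fun x => e (b x), (measurable_of_countable e).comp hb, fun D hD =>
    ⟨e '' {f | f ⟨D, hD⟩ = true}, ?_⟩⟩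
  ext x
  constructor
  · intro hx
    exact ⟨b x, by simp [b, hx], rfl⟩
  · rintro ⟨f, hf, hfx⟩
    rw [he hfx] at hf
    simpa [b] using hf

/-- A measure preserving map coincides with an invertible one on finitely many sets. -/
theorem exists_MPAut_preimage_ae_eq {π : X → X} (hπ : MeasurePreserving π μ μ)
    {𝒟 : Set (Set X)} (hf : 𝒟.Finite) (hm : ∀ D ∈ 𝒟, MeasurableSet D) :
    ∃ u : MPAut μ, ∀ D ∈ 𝒟, (u.1 '' D : Set X) =ᵐ[μ] (π ⁻¹' D : Set X) := by
  obtain ⟨κ, hκ, hκD⟩ := exists_nat_coding hf hm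
  -- Since π preserves the measure, κ ∘ π and κ have the same law. The resulting φ satisfies κ ∘ φ =
  -- κ ∘ π almost everywhere, and u is its inverse.
  obtain ⟨φ, hφ, hφκ⟩ := exists_measurableEquiv_of_distribution μ μ (hκ.comp hπ.measurable) hκ
    (by rw [← Measure.map_map hκ hπ.measurable, hπ.map_eq])
  refine ⟨⟨φ.toEquiv.symm, hφ.symm φ, hφ⟩, fun D hD => ?_⟩
  obtain ⟨s, rfl⟩ := hκD D hD
  rw [Equiv.image_eq_preimage_symm]
  filter_upwards [hφκ] with x hx
  change (κ (φ x) ∈ s) = (κ (π x) ∈ s)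
  rw [hx]
  rfl

/-- The conjugacy class of an action accumulates at each of its factors. -/
theorem exists_conjAction_eq_on_finite {π : X → X} {R T : MixingAction G μ}
    (h : IsFactorMap π R.1 T.1) {A : ℕ → Set X} (hA : ∀ i, MeasurableSet (A i))
    (F : Finset G) (N : ℕ) :
    ∃ u : MPAut μ, (∀ g ∈ F, ∀ i < N, discrepancy ((conjAction u R).1 g) (T.1 g) (A i) = 0) ∧
      ∀ g, ∀ i < N, ∀ j < N, overlap ((conjAction u R).1 g) (A i) (A j) =
        overlap (T.1 g) (A i) (A j) := by
  obtain ⟨hπ, hfac⟩ := h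
  choose τ σ hτ hσ hπτ using hfac
  have himg : ∀ g (D : Set X), (τ g).1 '' (π ⁻¹' D) = π ⁻¹' ((σ g).1 '' D) := by
    intro g D
    ext x
    rw [Equiv.image_eq_preimage_symm, Equiv.image_eq_preimage_symm]
    have h1 := hπτ g ((τ g).1.symm x)
    rw [Equiv.apply_symm_apply] at h1
    change π ((τ g).1.symm x) ∈ D ↔ (σ g).1.symm (π x) ∈ D
    rw [h1, Equiv.symm_apply_apply]
  -- The images under the factor action enter only for g in `F`; they serve the discrepancies. The
  -- overlaps need just the sets Aᵢ.
  set 𝒟 : Set (Set X) := (A '' Set.Iio N) ∪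
    (fun p : G × ℕ => (σ p.1).1 '' A p.2) '' ((F : Set G) ×ˢ Set.Iio N) with h𝒟
  have hf : 𝒟.Finite := ((Set.finite_Iio N).image _).union
    ((F.finite_toSet.prod (Set.finite_Iio N)).image _)
  have hm : ∀ D ∈ 𝒟, MeasurableSet D := by
    rintro _ (⟨i, -, rfl⟩ | ⟨p, -, rfl⟩)
    · exact hA i
    · exact MPAut.measurableSet_image _ (hA _)
  obtain ⟨u, hu⟩ := exists_MPAut_preimage_ae_eq hπ hf hm
  have hAi : ∀ i < N, (u.1 '' A i : Set X) =ᵐ[μ] (π ⁻¹' A i : Set X) := fun i hi =>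
    hu _ (Or.inl ⟨i, hi, rfl⟩)
  have hτA : ∀ g, ∀ i < N,
      ((τ g).1 '' (u.1 '' A i) : Set X) =ᵐ[μ] (π ⁻¹' ((σ g).1 '' A i) : Set X) := by
    intro g i hi
    rw [← himg, Equiv.image_eq_preimage_symm (τ g).1, Equiv.image_eq_preimage_symm (τ g).1]
    exact (τ g).2.2.quasiMeasurePreserving.preimage_ae_eq (hAi i hi)
  refine ⟨u, fun g hg i hi => ?_, fun g i hi j hj => ?_⟩
  · have h1 : T.1 g = (QuotientGroup.mk u : Transf μ)⁻¹ *
        (QuotientGroup.mk u * T.1 g * (QuotientGroup.mk u)⁻¹) * QuotientGroup.mk u := by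
      group
    rw [conjAction_apply, h1, discrepancy_conj u _ _ (hA i), hτ, hσ]
    change μ.real (((τ g).1 '' (u.1 '' A i)) ∆
      ((fun x => u.1 ((σ g).1 (u.1.symm x))) '' (u.1 '' A i))) = 0
    have h2 : (fun x => u.1 ((σ g).1 (u.1.symm x))) '' (u.1 '' A i) =
        u.1 '' ((σ g).1 '' A i) := by
      simp only [Set.image_image, Equiv.symm_apply_apply]
    rw [h2, measureReal_eq_zero_iff, measure_symmDiff_eq_zero_iff]
    exact (hτA g i hi).trans (hu _ (Or.inr ⟨(g, i), ⟨hg, hi⟩, rfl⟩)).symm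
  · rw [conjAction_apply, overlap_conj u _ (hA i) (hA j), hτ, hσ]
    change μ.real ((τ g).1 '' (u.1 '' A i) ∩ u.1 '' A j) = μ.real ((σ g).1 '' A i ∩ A j)
    -- Equivariance makes the intersection a π-preimage, so invariance under π gives equality for
    -- every g, including those outside `F`.
    rw [measureReal_congr ((hτA g i hi).inter (hAi j hj)), ← Set.preimage_inter,
      hπ.measureReal_preimage
        ((MPAut.measurableSet_image _ (hA i)).inter (hA j)).nullMeasurableSet]

theorem mem_closure_conjClass_of_isFactorMap {A : ℕ → Set X} (hA : IsGeneratingFamily μ A)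
    {ℓ : G → ℝ} (hℓ : Summable fun g => 1 / (2 : ℝ) ^ ℓ g) {π : X → X}
    {R T : MixingAction G μ} (h : IsFactorMap π R.1 T.1) :
    letI : MetricSpace (MixingAction G μ) := leadMetricSpace G μ A hA ℓ hℓ
    T ∈ closure (conjClass R) := by
  let _ : MetricSpace (MixingAction G μ) := leadMetricSpace G μ A hA ℓ hℓ
  choose u hd ho using exists_conjAction_eq_on_finite h hA.1
  have hlim : Tendsto (fun p : Finset G × ℕ => conjAction (u p.1 p.2) R)
      (atTop ×ˢ atTop) (𝓝 T) := by
    refine tendsto_iff_dist_tendsto_zero.2 ?_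
    have hN : ∀ i, ∀ᶠ p : Finset G × ℕ in atTop ×ˢ atTop, i < p.2 := fun i =>
      tendsto_snd.eventually (eventually_gt_atTop i)
    refine tendsto_leadDist (T := fun p : Finset G × ℕ => (conjAction (u p.1 p.2) R).1)
      (S := fun _ => T.1) hℓ (fun g i => ?_) (fun i j ε hε => ?_)
    · refine tendsto_const_nhds.congr' ?_
      have hF : ∀ᶠ p : Finset G × ℕ in atTop ×ˢ atTop, g ∈ p.1 :=
        tendsto_fst.eventually ((eventually_ge_atTop {g}).mono fun F hF =>
          Finset.singleton_subset_iff.1 hF)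
      filter_upwards [hF, hN i] with p hp hi
      exact (hd p.1 p.2 g hp i hi).symm
    · filter_upwards [hN i, hN j] with p hi hj g
      rw [ho p.1 p.2 g i hi j hj, sub_self, abs_zero]
      exact hε.le
  exact mem_closure_of_tendsto hlim
    (Eventually.of_forall fun p => mem_conjClass_iff.2 ⟨_, rfl⟩)

end Factor

/-! ### Genericity -/

/-- Density of a class need only be tested on a countable basis. Each test is an open condition on
T, being a union over u of preimages under continuous conjugations. -/
theorem isGδ_denseConjSet {X : Type*} [MeasurableSpace X] [StandardBorelSpace X]
    {μ : Measure X} [IsProbabilityMeasure μ] {G : Type*} [Group G] [Countable G]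
    {A : ℕ → Set X} (hA : IsGeneratingFamily μ A) {ℓ : G → ℝ}
    (hℓ : Summable fun g => 1 / (2 : ℝ) ^ ℓ g) :
    letI : MetricSpace (MixingAction G μ) := leadMetricSpace G μ A hA ℓ hℓ
    IsGδ (denseConjSet G μ) := by
  let _ : MetricSpace (MixingAction G μ) := leadMetricSpace G μ A hA ℓ hℓ
  have : SecondCountableTopology (MixingAction G μ) := secondCountable_leadMetricSpace hA hℓ
  have hb := TopologicalSpace.isBasis_countableBasis (MixingAction G μ)
  have h : denseConjSet G μ = ⋂ V ∈ {V ∈ TopologicalSpace.countableBasis (MixingAction G μ) |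
      V.Nonempty}, ⋃ u : MPAut μ, conjAction u ⁻¹' V := by
    ext T
    simp only [Set.mem_iInter, Set.mem_iUnion, Set.mem_preimage]
    change closure (conjClass T) = Set.univ ↔ _
    rw [← dense_iff_closure_eq, hb.dense_iff]
    refine forall_congr' fun V => ⟨fun h hV => ?_, fun h hV hne => ?_⟩
    · obtain ⟨S, hSV, hS⟩ := h hV.1 hV.2
      obtain ⟨u, rfl⟩ := mem_conjClass_iff.1 hS
      exact ⟨u, hSV⟩
    · obtain ⟨u, hu⟩ := h ⟨hV, hne⟩
      exact ⟨_, hu, mem_conjClass_iff.2 ⟨u, rfl⟩⟩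
  rw [h]
  refine IsGδ.biInter ((TopologicalSpace.countable_countableBasis _).mono fun V hV => hV.1)
    fun V hV => (isOpen_iUnion fun u => ?_).isGδ
  exact (hb.isOpen hV.1).preimage (continuous_conjAction hA hℓ u)

end MixingActions

theorem mainTheorem2 {X : Type*} [MeasurableSpace X] [StandardBorelSpace X]
    (μ : MeasureTheory.Measure X) [MeasureTheory.IsProbabilityMeasure μ]
    [MeasureTheory.NullSingletonClass μ] (G : Type*) [Group G] [Countable G]
    (A : ℕ → Set X) (hA : MixingActions.IsGeneratingFamily μ A)
    (ℓ : G → ℝ) (hℓ_pos : ∀ g, 0 < ℓ g) (hℓ : Summable fun g => 1 / (2 : ℝ) ^ ℓ g) :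
    letI : MetricSpace (MixingActions.MixingAction G μ) :=
      MixingActions.leadMetricSpace G μ A hA ℓ hℓ
    IsGδ (MixingActions.denseConjSet G μ) ∧ Dense (MixingActions.denseConjSet G μ) := by
  open MixingActions in
  let _ : MetricSpace (MixingAction G μ) := leadMetricSpace G μ A hA ℓ hℓ
  have : SecondCountableTopology (MixingAction G μ) := secondCountable_leadMetricSpace hA hℓ
  refine ⟨isGδ_denseConjSet hA hℓ, ?_⟩
  -- A dense sequence exists only in a nonempty space; density is vacuous otherwise.
  rcases isEmpty_or_nonempty (MixingAction G μ) with hem | hne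
  · exact fun T => hem.elim T
  obtain ⟨R, hR⟩ := exists_common_extension (TopologicalSpace.denseSeq (MixingAction G μ))
  have hRd : Dense (conjClass R) := by
    refine dense_closure.1 ((TopologicalSpace.denseRange_denseSeq _).mono ?_)
    rintro _ ⟨n, rfl⟩
    obtain ⟨π, hπ⟩ := hR n
    exact mem_closure_conjClass_of_isFactorMap hA hℓ hπ
  -- Every conjugate of `R` has the same conjugacy class, so the dense class of `R` is contained in
  -- W.
  refine hRd.mono fun S hS => ?_
  change closure (conjClass S) = Set.univ
  rw [conjClass_eq_of_mem hS]
  exact hRd.closure_eq
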